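/- Let $d\in\mathbb N$, let $s>d/2$ be real, and let $f:\mathbb{C}\to\mathbb{C}$ be smooth in the real sense (i.e. $C^\infty$ as a map $\mathbb{R}^2\to\mathbb{R}^2$) with $f(0)=0$. Write $f'(z)\in\mathcal{L}_{\mathbb R}(\mathbb{C})$ for the real derivative of $f$ at $z$, and put $\mathsf{H}_1=H^s(\mathbb{R}^d)=H^s(\mathbb{R}^d;\mathbb{C})$ and $\mathsf{H}_0=L^2(\mathbb{R}^d;\mathbb{C})$. Then: (i) $B(u)(x)=f(u(x))$ (for a.e. $x$) is a well-defined map $B:\mathsf{H}_1\to\mathsf{H}_1$, and it is locally Lipschitz in the sense that it is Lipschitz on every ball of $\mathsf{H}_1$ centred at the origin; (ii) $(B'(u)v)(x)=f'(u(x))\,v(x)$ (for a.e. $x$), where $u\in\mathsf{H}_1$ and $v\in\mathsf{H}_0$, is a well-defined map $B':\mathsf{H}_1\to\mathcal{B}(\mathsf{H}_0)$ into the bounded real-linear operators on $\mathsf{H}_0$; (iii) for all $R,\varepsilon>0$ there are $C,\delta>0$ such that, for all $u,w\in\mathsf{H}_1$ with $\|u\|_{\mathsf{H}_1}\le R$ and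 $\|w\|_{\mathsf{H}_1}<\delta$, $$\|B'(u)\|_{\mathcal{B}(\mathsf{H}_0)}\le C,\qquad \|B(u+w)-B(u)-B'(u)w\|_{\mathsf{H}_0}\le\varepsilon\|w\|_{\mathsf{H}_0}.$$ -/

import Mathlib

open MeasureTheory FourierTransform
open scoped ENNReal NNReal ContDiff SchwartzMap

noncomputable section

namespace LocalNonlinearity

/-- `ℝ^d` with its Euclidean structure. -/
abbrev Rd (d : ℕ) : Type := EuclideanSpace ℝ (Fin d)

/-- The Hilbert space `L²(ℝ^d; ℂ)`. -/
abbrev L2 (d : ℕ) : Type := Lp ℂ 2 (volume : Measure (Rd d))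

/-- The function `ξ ↦ (1 + |ξ|²)^{s/2} û(ξ)`, where `û` is the Fourier–Plancherel transform of the
`L²` function `u` (with kernel `e^{-2πi x·ξ}`). -/
def weightedFourierFun (d : ℕ) (s : ℝ) (u : L2 d) : Rd d → ℂ :=
  fun ξ => (((1 + ‖ξ‖ ^ 2) ^ (s / 2) : ℝ) : ℂ) * (𝓕 u : L2 d) ξ

theorem weightedFourierFun_add (d : ℕ) (s : ℝ) (u v : L2 d) :
    weightedFourierFun d s (u + v) =ᵐ[volume]
      weightedFourierFun d s u + weightedFourierFun d s v := by
  have h : (𝓕 (u + v) : L2 d) = 𝓕 u + 𝓕 v := FourierTransform.fourier_add u v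
  filter_upwards [Lp.coeFn_add (𝓕 u : L2 d) (𝓕 v)] with ξ hξ
  simp only [weightedFourierFun, Pi.add_apply, h, hξ]
  ring

theorem weightedFourierFun_smul (d : ℕ) (s : ℝ) (c : ℂ) (u : L2 d) :
    weightedFourierFun d s (c • u) =ᵐ[volume] c • weightedFourierFun d s u := by
  have h : (𝓕 (c • u) : L2 d) = c • 𝓕 u := FourierTransform.fourier_smul c u
  filter_upwards [Lp.coeFn_smul c (𝓕 u : L2 d)] with ξ hξ
  simp only [weightedFourierFun, Pi.smul_apply, h, hξ, smul_eq_mul]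
  ring

theorem weightedFourierFun_zero (d : ℕ) (s : ℝ) :
    weightedFourierFun d s 0 =ᵐ[volume] 0 := by
  simpa using weightedFourierFun_smul d s 0 0

/-- The functions `u ∈ L²(ℝ^d)` with `(1 + |ξ|²)^{s/2} û ∈ L²(ℝ^d)`, as a subspace of `L²`. -/
def sobolevSubmodule (d : ℕ) (s : ℝ) : Submodule ℂ (L2 d) where
  carrier := {u | MemLp (weightedFourierFun d s u) 2 volume}
  zero_mem' := MemLp.zero.ae_eq (weightedFourierFun_zero d s).symm
  add_mem' {u v} hu hv := (MemLp.add hu hv).ae_eq (weightedFourierFun_add d s u v).symm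
  smul_mem' c u hu := (MemLp.const_smul hu c).ae_eq (weightedFourierFun_smul d s c u).symm

theorem memLp_weightedFourierFun {d : ℕ} {s : ℝ} (u : sobolevSubmodule d s) :
    MemLp (weightedFourierFun d s (u : L2 d)) 2 volume := u.2

/-- The linear map `u ↦ (1 + |ξ|²)^{s/2} û` into `L²(ℝ^d)`. -/
def weightedFourier (d : ℕ) (s : ℝ) : sobolevSubmodule d s →ₗ[ℂ] L2 d where
  toFun u := (memLp_weightedFourierFun u).toLp
  map_add' u v := by
    exact (MemLp.toLp_congr _
      ((memLp_weightedFourierFun u).add (memLp_weightedFourierFun v)) (weightedFourierFun_add d s u.1 v.1)).trans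
      (MemLp.toLp_add _ _)
  map_smul' c u := by
    exact (MemLp.toLp_congr _ ((memLp_weightedFourierFun u).const_smul c)
      (weightedFourierFun_smul d s c u.1)).trans (MemLp.toLp_const_smul _ _)

theorem weightedFourier_injective (d : ℕ) (s : ℝ) :
    Function.Injective (weightedFourier d s) := by
  rw [← LinearMap.ker_eq_bot, LinearMap.ker_eq_bot']
  intro u hu
  have h1 : weightedFourierFun d s u.1 =ᵐ[volume] 0 :=
    (MemLp.coeFn_toLp u.2).symm.trans ((Lp.eq_zero_iff_ae_eq_zero).1 hu)
  have h2 : (𝓕 u.1 : L2 d) = 0 := by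
    rw [Lp.eq_zero_iff_ae_eq_zero]
    filter_upwards [h1] with ξ hξ
    have h0 : (((1 + ‖ξ‖ ^ 2) ^ (s / 2) : ℝ) : ℂ) ≠ 0 := by
      rw [Complex.ofReal_ne_zero]
      positivity
    exact (mul_eq_zero.1 hξ).resolve_left h0
  refine Subtype.ext ?_
  rw [ZeroMemClass.coe_zero, ← norm_eq_zero, ← Lp.norm_fourier_eq, h2, norm_zero]

/-- The Sobolev space `H^s(ℝ^d)` of complex-valued functions, for a real order `s ≥ 0`.
Its norm, introduced below, is not the one inherited from `L²`. -/
def Hs (d : ℕ) (s : ℝ) : Type := sobolevSubmodule d s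

instance (d : ℕ) (s : ℝ) : AddCommGroup (Hs d s) :=
  inferInstanceAs (AddCommGroup (sobolevSubmodule d s))

instance (d : ℕ) (s : ℝ) : Module ℂ (Hs d s) :=
  inferInstanceAs (Module ℂ (sobolevSubmodule d s))

/-- The inclusion of `H^s(ℝ^d)` into `L²(ℝ^d)`. -/
def Hs.toL2 {d : ℕ} {s : ℝ} : Hs d s →ₗ[ℂ] L2 d := (sobolevSubmodule d s).subtype

/-- The map `u ↦ (1 + |ξ|²)^{s/2} û` from `H^s(ℝ^d)` to `L²(ℝ^d)`. -/
def Hs.weightedFourier (d : ℕ) (s : ℝ) : Hs d s →ₗ[ℂ] L2 d :=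
  LocalNonlinearity.weightedFourier d s

/-- The norm `‖u‖_{H^s} = ‖(1 + |ξ|²)^{s/2} û‖_{L²}`. -/
instance (d : ℕ) (s : ℝ) : NormedAddCommGroup (Hs d s) :=
  NormedAddCommGroup.induced (Hs d s) (L2 d) (Hs.weightedFourier d s)
    (weightedFourier_injective d s)

/-- The inner product `⟪u, v⟫_{H^s} = ⟪(1 + |ξ|²)^{s/2} û, (1 + |ξ|²)^{s/2} v̂⟫_{L²}`. -/
instance (d : ℕ) (s : ℝ) : InnerProductSpace ℂ (Hs d s) :=
  InnerProductSpace.induced (Hs.weightedFourier d s)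

theorem Hs.norm_eq {d : ℕ} {s : ℝ} (u : Hs d s) :
    ‖u‖ = (eLpNorm (weightedFourierFun d s u.toL2) 2 volume).toReal :=
  Lp.norm_toLp _ u.2

/-- Membership agrees with Mathlib's Sobolev condition on the tempered distribution `u`. -/
theorem mem_sobolevSubmodule_iff {d : ℕ} {s : ℝ} {u : L2 d} :
    u ∈ sobolevSubmodule d s ↔ TemperedDistribution.MemSobolev s 2 (u : 𝓢'(Rd d, ℂ)) := by
  have hw : (fun ξ : Rd d => (((1 + ‖ξ‖ ^ 2) ^ (s / 2) : ℝ) : ℂ)).HasTemperateGrowth := by fun_prop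
  have hL : ∀ g : 𝓢(Rd d, ℂ), TemperedDistribution.smulLeftCLM ℂ
      (fun ξ : Rd d => (((1 + ‖ξ‖ ^ 2) ^ (s / 2) : ℝ) : ℂ)) (𝓕 (u : 𝓢'(Rd d, ℂ))) g
      = ∫ ξ, g ξ • weightedFourierFun d s u ξ := by
    intro g
    rw [Lp.fourier_toTemperedDistribution_eq, TemperedDistribution.smulLeftCLM_apply_apply,
      Lp.toTemperedDistribution_apply]
    refine integral_congr_ae (Filter.Eventually.of_forall fun ξ => ?_)
    simp only [SchwartzMap.smulLeftCLM_apply_apply hw, weightedFourierFun, smul_eq_mul]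
    ring
  rw [TemperedDistribution.memSobolev_iff_exists_smulLeftCLM_fourier]
  constructor
  · intro hu
    refine ⟨MemLp.toLp _ hu, ?_⟩
    ext g
    rw [hL, Lp.toTemperedDistribution_apply]
    refine integral_congr_ae ?_
    filter_upwards [MemLp.coeFn_toLp hu] with ξ hξ
    rw [hξ]
  · rintro ⟨v, hv⟩
    have hloc : LocallyIntegrable (weightedFourierFun d s u) volume := by
      have h2 : LocallyIntegrable (𝓕 u : L2 d) volume :=
        (Lp.memLp (𝓕 u : L2 d)).locallyIntegrable (by norm_num)
      have h4 := (locallyIntegrableOn_univ.2 h2).continuousOn_mul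
        hw.1.continuous.continuousOn isOpen_univ.isLocallyClosed
      exact locallyIntegrableOn_univ.1 h4
    have hae : ∀ᵐ ξ ∂volume, weightedFourierFun d s u ξ = v ξ := by
      refine ae_eq_of_integral_contDiff_smul_eq hloc
        ((Lp.memLp v).locallyIntegrable (by norm_num)) fun g hg hgc => ?_
      have hg₁ : HasCompactSupport (Complex.ofRealCLM ∘ g) := hgc.comp_left rfl
      have hg₂ : ContDiff ℝ ∞ (Complex.ofRealCLM ∘ g) := by fun_prop
      have h3 := congrArg (fun T : 𝓢'(Rd d, ℂ) => T (hg₁.toSchwartzMap hg₂)) hv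
      simp only [hL, Lp.toTemperedDistribution_apply] at h3
      simpa using h3
    exact (Lp.memLp v).ae_eq (Filter.EventuallyEq.symm hae)

end LocalNonlinearity

end

/-! Since `s > d/2`, elements of `H^s` have representatives bounded by `E‖u‖`. On a ball of `H^s`
only the values of `f` on a disc matter, and there `f` agrees with a Schwartz function `g`. Fourier
inversion on `ℂ` gives `g(u) - g(0) = ∫ ĝ(ζ) (e^{2πi⟨u,ζ⟩} - 1) dζ`, read as a Bochner integral in
`H^s`. It converges, and is Lipschitz in `u` on balls, once `‖e^φ - 1‖` grows only polynomially in
`‖φ‖` for imaginary `φ`; the exponential series alone gives exponential growth.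

The polynomial bound (`exists_norm_expm1_le`) rests on the product estimate `exists_mul`:
multiplication by `c + φ` costs `sup |c + φ|` with constant exactly one, plus a term in a weaker
norm `H^ρ`. On the Fourier side this term is the commutator of the weight with convolution
(`exists_lintegral_commutator_le`), and interpolation trades `H^ρ` for a little `H^s` and much `L²`.
Write `e^φ` as a product of about `‖φ‖` factors `e^ψ` with `‖ψ‖ ≤ 1`. They have modulus one, so each
factor adds to the norm instead of multiplying it, while the `L²` norms stay below `‖φ‖`.

The `L²` statements are pointwise: `f'` is bounded and uniformly continuous on discs, and a small
`H^s` norm of `w` makes `w` uniformly small. -/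

noncomputable section

namespace LocalNonlinearity

/-- The weight `(1 + |ξ|²)^{s/2}`. -/
def weight {d : ℕ} (s : ℝ) (ξ : Rd d) : ℝ := (1 + ‖ξ‖ ^ 2) ^ (s / 2)

/-! ### Pointwise estimates for the Sobolev weight -/

section Weight
variable {d : ℕ}

theorem weight_pos (s : ℝ) (ξ : Rd d) : 0 < weight s ξ := by
  unfold weight; positivity

theorem weight_mul (s t : ℝ) (ξ : Rd d) : weight s ξ * weight t ξ = weight (s + t) ξ := by
  unfold weight
  rw [← Real.rpow_add (by positivity)]
  ring_nf

@[simp] theorem weight_zero (ξ : Rd d) : weight 0 ξ = 1 := by simp [weight]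

theorem weight_neg_mul (s : ℝ) (ξ : Rd d) : weight (-s) ξ * weight s ξ = 1 := by
  rw [weight_mul]; simp

theorem weight_mono {s t : ℝ} (h : s ≤ t) (ξ : Rd d) : weight s ξ ≤ weight t ξ :=
  Real.rpow_le_rpow_of_exponent_le (by nlinarith [sq_nonneg ‖ξ‖]) (by linarith)

theorem one_le_weight {s : ℝ} (hs : 0 ≤ s) (ξ : Rd d) : 1 ≤ weight s ξ := by
  simpa using weight_mono hs ξ

theorem weight_one_rpow (s : ℝ) (ξ : Rd d) : weight 1 ξ ^ s = weight s ξ := by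
  unfold weight
  rw [← Real.rpow_mul (by positivity)]
  ring_nf

@[fun_prop] theorem continuous_weight (s : ℝ) : Continuous (weight s : Rd d → ℝ) := by
  unfold weight
  exact Continuous.rpow_const (by fun_prop) fun ξ => Or.inl (by positivity)

@[fun_prop] theorem measurable_weight (s : ℝ) : Measurable (weight s : Rd d → ℝ) :=
  (continuous_weight s).measurable

theorem weight_neg (s : ℝ) (ξ : Rd d) : weight s (-ξ) = weight s ξ := by simp [weight]

theorem abs_weight_one_sub_le (ξ η : Rd d) :
    |weight 1 ξ - weight 1 η| ≤ weight 1 (ξ - η) := by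
  have hsq : ∀ ζ : Rd d, weight 1 ζ ^ 2 = 1 + ‖ζ‖ ^ 2 := fun ζ => by
    have := weight_mul 1 1 ζ
    rw [sq, this]; norm_num [weight]
  have h1 := weight_pos 1 ξ
  have h2 := weight_pos 1 η
  have h3 := weight_pos 1 (ξ - η)
  have hd : (‖ξ‖ - ‖η‖) ^ 2 ≤ ‖ξ - η‖ ^ 2 := by
    rw [← sq_abs]
    exact pow_le_pow_left₀ (abs_nonneg _) (abs_norm_sub_norm_le ξ η) 2
  have hprod : 1 + ‖ξ‖ * ‖η‖ ≤ weight 1 ξ * weight 1 η := by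
    apply le_of_sq_le_sq _ (by positivity)
    rw [mul_pow, hsq, hsq]
    nlinarith [sq_nonneg (‖ξ‖ - ‖η‖)]
  apply le_of_sq_le_sq _ h3.le
  rw [sq_abs, sub_sq, hsq, hsq, hsq]
  nlinarith

/-- On either side of `1`, raising the exponent to an integer `N ≥ s` moves the power further from
`1`; `t ^ N - 1` is then factored by a geometric sum. -/
theorem exists_abs_rpow_sub_one_le {s : ℝ} (hs : 0 < s) :
    ∃ K : ℝ, 0 ≤ K ∧ ∀ t : ℝ, 0 ≤ t → t ≤ 2 → |t ^ s - 1| ≤ K * |t - 1| := by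
  obtain ⟨N, hN⟩ := exists_nat_ge s
  have hN0 : (N : ℝ) ≠ 0 := by linarith
  refine ⟨N * 2 ^ N, by positivity, fun t ht ht2 => ?_⟩
  have hgeom : |t ^ N - 1| ≤ N * 2 ^ N * |t - 1| := by
    rw [← mul_geom_sum, mul_comm, abs_mul]
    refine mul_le_mul_of_nonneg_right ?_ (abs_nonneg _)
    refine (Finset.abs_sum_le_sum_abs _ _).trans ?_
    refine (Finset.sum_le_card_nsmul _ _ ((2 : ℝ) ^ N) fun i hi => ?_).trans (by simp)
    rw [abs_of_nonneg (by positivity)]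
    exact (pow_le_pow_left₀ ht ht2 i).trans
      (pow_le_pow_right₀ one_le_two (Finset.mem_range.1 hi).le)
  refine le_trans ?_ hgeom
  rw [← Real.rpow_natCast]
  rcases le_total 1 t with h | h
  · rw [abs_of_nonneg (by linarith [Real.one_le_rpow h hs.le]),
      abs_of_nonneg (by linarith [Real.one_le_rpow h (hs.le.trans hN)])]
    linarith [Real.rpow_le_rpow_of_exponent_le h hN]
  · rw [abs_of_nonpos (by linarith [Real.rpow_le_one ht h hs.le]),
      abs_of_nonpos (by linarith [Real.rpow_le_one ht h (hs.le.trans hN)])]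
    have : t ^ (N : ℝ) ≤ t ^ s := Real.rpow_le_rpow_of_exponent_ge' ht h hs.le hN
    linarith

/-- If `y ≤ z`, both powers are at most a multiple of `z ^ s`. If `z ≤ y`, dividing by `y` gives a
bound `z * y ^ (s - 1)`, and `s - ρ ≤ 1` allows powers of `z / y ≤ 1` to be given away. -/
theorem exists_abs_rpow_sub_rpow_le {s ρ : ℝ} (hs : 0 < s) (hsρ : s - 1 ≤ ρ) :
    ∃ C : ℝ, 0 ≤ C ∧ ∀ x y z : ℝ, 1 ≤ x → 1 ≤ y → 1 ≤ z → |x - y| ≤ z →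
      |x ^ s - y ^ s| ≤ C * (z ^ s + z ^ (s - ρ) * y ^ ρ) := by
  obtain ⟨K, hK, hKt⟩ := exists_abs_rpow_sub_one_le hs
  refine ⟨K + 2 ^ s, by positivity, fun x y z hx hy hz hxyz => ?_⟩
  have hx0 : 0 < x := by linarith
  have hy0 : 0 < y := by linarith
  have hz0 : 0 < z := by linarith
  have hA : 0 ≤ z ^ s := by positivity
  have hB : 0 ≤ z ^ (s - ρ) * y ^ ρ := by positivity
  have h2 : (0 : ℝ) ≤ 2 ^ s := by positivity
  rcases le_total y z with h | h
  · have hxz : x ≤ 2 * z := by linarith [(abs_le.1 hxyz).2]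
    have h1 : x ^ s ≤ 2 ^ s * z ^ s := by
      rw [← Real.mul_rpow (by norm_num) hz0.le]
      exact Real.rpow_le_rpow hx0.le hxz hs.le
    have h1' : y ^ s ≤ 2 ^ s * z ^ s := by
      rw [← Real.mul_rpow (by norm_num) hz0.le]
      exact Real.rpow_le_rpow hy0.le (by linarith) hs.le
    have : |x ^ s - y ^ s| ≤ 2 ^ s * z ^ s := by
      rw [abs_le]
      constructor <;> linarith [Real.rpow_nonneg hx0.le s, Real.rpow_nonneg hy0.le s]
    nlinarith [mul_nonneg hK hA, mul_nonneg hK hB, mul_nonneg h2 hB]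
  · have ht2 : x / y ≤ 2 := by
      rw [div_le_iff₀ hy0]; linarith [(abs_le.1 hxyz).2]
    have h1 := hKt (x / y) (by positivity) ht2
    rw [Real.div_rpow hx0.le hy0.le, div_sub_one (by positivity), div_sub_one hy0.ne',
      abs_div, abs_div, abs_of_pos hy0, abs_of_pos (Real.rpow_pos_of_pos hy0 s),
      div_le_iff₀ (by positivity)] at h1
    have h3 : z / y * y ^ s ≤ z ^ (s - ρ) * y ^ ρ := by
      have e1 : z / y * y ^ s = z ^ (s - ρ) * y ^ ρ * (z / y) ^ (1 - (s - ρ)) := by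
        rw [Real.div_rpow hz0.le hy0.le, Real.rpow_sub hz0 1, Real.rpow_one, Real.rpow_sub hy0 1,
          Real.rpow_one, Real.rpow_sub hy0 s ρ]
        have := (Real.rpow_pos_of_pos hy0 s).ne'
        have := (Real.rpow_pos_of_pos hy0 ρ).ne'
        have := (Real.rpow_pos_of_pos hz0 (s - ρ)).ne'
        field_simp
      rw [e1]
      refine mul_le_of_le_one_right hB ?_
      exact Real.rpow_le_one (by positivity) ((div_le_one hy0).2 h) (by linarith)
    have h4 : |x ^ s - y ^ s| ≤ K * (z / y * y ^ s) := by
      refine h1.trans ?_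
      rw [mul_assoc]
      gcongr
    nlinarith [mul_le_mul_of_nonneg_left h3 hK, mul_nonneg hK hA, mul_nonneg h2 hA,
      mul_nonneg h2 hB]

/-- The bound is factored so that each summand has a spare weight of order `-ρ`, which is square
integrable for `ρ > d/2`. -/
theorem exists_abs_weight_sub_le (d : ℕ) {s ρ : ℝ} (hs : 0 < s) (hsρ : s - 1 ≤ ρ) :
    ∃ C : ℝ, 0 ≤ C ∧ ∀ ξ η : Rd d, |weight s ξ - weight s η| ≤
      C * (weight s (ξ - η) * weight ρ η * (weight (-ρ) η + weight (-ρ) (ξ - η))) := by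
  obtain ⟨C, hC, h⟩ := exists_abs_rpow_sub_rpow_le hs hsρ
  refine ⟨C, hC, fun ξ η => ?_⟩
  have h1 := h (weight 1 ξ) (weight 1 η) (weight 1 (ξ - η)) (one_le_weight zero_le_one _)
    (one_le_weight zero_le_one _) (one_le_weight zero_le_one _) (abs_weight_one_sub_le ξ η)
  simp only [weight_one_rpow] at h1
  refine h1.trans_eq ?_
  have e1 := weight_neg_mul ρ η
  have e2 : weight (s - ρ) (ξ - η) = weight s (ξ - η) * weight (-ρ) (ξ - η) := by
    rw [weight_mul]; ring_nf
  rw [e2]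
  linear_combination (-C * weight s (ξ - η)) * e1

theorem memLp_weight_neg {r : ℝ} (hr : (d : ℝ) / 2 < r) :
    MemLp (weight (-r) : Rd d → ℝ) 2 volume := by
  rw [memLp_two_iff_integrable_sq (continuous_weight _).aestronglyMeasurable]
  have h : (Module.finrank ℝ (Rd d) : ℝ) < 2 * r := by simp; linarith
  refine (integrable_rpow_neg_one_add_norm_sq (E := Rd d) (μ := volume) h).congr
    (Filter.Eventually.of_forall fun ξ => ?_)
  simp only [sq (weight (-r) ξ), weight_mul]
  unfold weight
  ring_nf

end Weight

/-! ### Young's inequality `L¹ ⋆ L² ⊆ L²` -/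

section Young
variable {d : ℕ}

theorem eLpNorm_two_ennreal (p : Rd d → ℝ≥0∞) :
    eLpNorm p 2 volume = (∫⁻ x, p x ^ 2) ^ (1 / 2 : ℝ) := by
  rw [eLpNorm_eq_lintegral_rpow_enorm_toReal (by norm_num) (by norm_num)]
  simp

theorem lintegral_mul_le_eLpNorm_two {p q : Rd d → ℝ≥0∞} (hp : AEMeasurable p)
    (hq : AEMeasurable q) :
    ∫⁻ x, p x * q x ≤ eLpNorm p 2 volume * eLpNorm q 2 volume := by
  have := ENNReal.lintegral_mul_le_Lp_mul_Lq volume Real.HolderConjugate.two_two hp hq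
  simpa [eLpNorm_two_ennreal] using this

/-- Cauchy–Schwarz with the splitting `p^{1/2} · (p^{1/2} q)` bounds the square of the convolution
by `‖p‖₁ (p ⋆ q²)`; Tonelli integrates this. -/
theorem eLpNorm_lconvolution_le {p q : Rd d → ℝ≥0∞} (hp : AEMeasurable p)
    (hq : AEMeasurable q) :
    eLpNorm (p ⋆ₗ q) 2 volume ≤ (∫⁻ x, p x) * eLpNorm q 2 volume := by
  have hqm : ∀ x : Rd d, AEMeasurable (fun y => q (-y + x)) := fun x =>
    hq.comp_quasiMeasurePreserving
      (by simpa [neg_add_eq_sub] using quasiMeasurePreserving_sub_left_of_right_invariant volume x)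
  have hpt : ∀ x, (p ⋆ₗ q) x ^ 2 ≤ (∫⁻ y, p y) * (p ⋆ₗ (fun y => q y ^ 2)) x := fun x => by
    have h := ENNReal.lintegral_mul_le_Lp_mul_Lq volume Real.HolderConjugate.two_two
      (f := fun y => p y ^ (1 / 2 : ℝ)) (g := fun y => p y ^ (1 / 2 : ℝ) * q (-y + x))
      (hp.pow_const _) ((hp.pow_const _).mul (hqm x))
    have e0 : ∀ a : ℝ≥0∞, a ^ (1 / 2 : ℝ) * a ^ (1 / 2 : ℝ) = a := fun a => by
      rw [← ENNReal.rpow_add_of_nonneg _ _ (by norm_num) (by norm_num)]; norm_num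
    have e1 : ∀ a : ℝ≥0∞, (a ^ (1 / 2 : ℝ)) ^ (2 : ℝ) = a := fun a => by
      rw [← ENNReal.rpow_mul]; norm_num
    have e2 : ∀ a b : ℝ≥0∞, (a ^ (1 / 2 : ℝ) * b) ^ (2 : ℝ) = a * b ^ 2 := fun a b => by
      rw [ENNReal.mul_rpow_of_nonneg _ _ (by norm_num), e1]; norm_num
    simp only [Pi.mul_apply, ← mul_assoc, e0, e1, e2] at h
    have h2 := pow_le_pow_left₀ (zero_le) h 2
    refine h2.trans_eq ?_
    rw [sq, mul_mul_mul_comm, e0, e0]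
    rfl
  have hsq : ∫⁻ x, (p ⋆ₗ q) x ^ 2 ≤ (∫⁻ y, p y) ^ 2 * ∫⁻ y, q y ^ 2 := by
    calc ∫⁻ x, (p ⋆ₗ q) x ^ 2 ≤ ∫⁻ x, (∫⁻ y, p y) * (p ⋆ₗ (fun y => q y ^ 2)) x :=
          lintegral_mono hpt
      _ = (∫⁻ y, p y) * ∫⁻ x, (p ⋆ₗ (fun y => q y ^ 2)) x :=
          lintegral_const_mul'' _ (aemeasurable_lconvolution hp (hq.pow_const 2))
      _ = (∫⁻ y, p y) * ((∫⁻ y, p y) * ∫⁻ y, q y ^ 2) := by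
          congr 1
          simp only [lconvolution_def]
          rw [lintegral_lintegral_swap]
          · rw [← lintegral_mul_const'' _ hp]
            refine lintegral_congr fun y => ?_
            rw [lintegral_const_mul'', lintegral_add_left_eq_self (fun x => q x ^ 2)]
            exact (hq.comp_quasiMeasurePreserving
              (measurePreserving_add_left volume (-y)).quasiMeasurePreserving).pow_const 2
          · fun_prop
      _ = _ := by rw [sq, mul_assoc]
  rw [eLpNorm_two_ennreal, eLpNorm_two_ennreal]
  refine (ENNReal.rpow_le_rpow hsq (by norm_num)).trans_eq ?_
  rw [ENNReal.mul_rpow_of_nonneg _ _ (by norm_num), ← ENNReal.rpow_natCast, ← ENNReal.rpow_mul]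
  norm_num

end Young

/-! ### Convolution of complex functions -/

section Convolution
variable {d : ℕ}

/-- The convolution of complex-valued functions on `ℝ^d`. -/
def conv (a b : Rd d → ℂ) : Rd d → ℂ := convolution a b (ContinuousLinearMap.mul ℂ ℂ) volume

theorem conv_apply (a b : Rd d → ℂ) (ξ : Rd d) : conv a b ξ = ∫ t, a t * b (ξ - t) := rfl

theorem enorm_conv_le (a b : Rd d → ℂ) (ξ : Rd d) :
    ‖conv a b ξ‖ₑ ≤ ((fun t => ‖a t‖ₑ) ⋆ₗ fun t => ‖b t‖ₑ) ξ := by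
  rw [conv_apply]
  refine (enorm_integral_le_lintegral_enorm _).trans_eq ?_
  simp [lconvolution_def, neg_add_eq_sub]

theorem aestronglyMeasurable_conv {a b : Rd d → ℂ} (ha : AEStronglyMeasurable a)
    (hb : AEStronglyMeasurable b) : AEStronglyMeasurable (conv a b) :=
  (ha.convolution_integrand (ContinuousLinearMap.mul ℂ ℂ) hb).integral_prod_right'

theorem eLpNorm_conv_le {a b : Rd d → ℂ} (ha : AEStronglyMeasurable a)
    (hb : AEStronglyMeasurable b) :
    eLpNorm (conv a b) 2 volume ≤ (∫⁻ x, ‖a x‖ₑ) * eLpNorm b 2 volume := by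
  refine le_trans (eLpNorm_mono_enorm (g := (fun t => ‖a t‖ₑ) ⋆ₗ fun t => ‖b t‖ₑ) fun ξ => ?_)
    ((eLpNorm_lconvolution_le ha.enorm hb.enorm).trans_eq ?_)
  · simpa using enorm_conv_le a b ξ
  · rw [eLpNorm_enorm]

theorem ae_convolutionExistsAt {a b : Rd d → ℂ} (ha : Integrable a) (hb : MemLp b 2) :
    ∀ᵐ ξ, Integrable fun t => a t * b (ξ - t) := by
  have h : MemLp ((fun t => ‖a t‖ₑ) ⋆ₗ fun t => ‖b t‖ₑ) 2 (volume : Measure (Rd d)) :=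
    ⟨(aemeasurable_lconvolution ha.1.enorm hb.1.enorm).aestronglyMeasurable,
      (eLpNorm_lconvolution_le ha.1.enorm hb.1.enorm).trans_lt
        (ENNReal.mul_lt_top ha.2 (by rw [eLpNorm_enorm]; exact hb.2))⟩
  rw [MemLp, eLpNorm_two_ennreal] at h
  have h2 : ∫⁻ ξ, ((fun t => ‖a t‖ₑ) ⋆ₗ fun t => ‖b t‖ₑ) ξ ^ 2 ≠ ⊤ := fun h' => by
    rw [h'] at h
    simp at h
  filter_upwards [ae_lt_top' (h.1.aemeasurable.pow_const 2) h2] with ξ hξ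
  refine ⟨ha.1.convolution_integrand_snd (ContinuousLinearMap.mul ℂ ℂ) hb.1 ξ, ?_⟩
  have h3 : ((fun t => ‖a t‖ₑ) ⋆ₗ fun t => ‖b t‖ₑ) ξ < ⊤ := by
    rw [lt_top_iff_ne_top] at hξ ⊢
    intro h4
    simp [h4] at hξ
  simpa [HasFiniteIntegral, lconvolution_def, neg_add_eq_sub] using h3

theorem memLp_conv {a b : Rd d → ℂ} (ha : Integrable a) (hb : MemLp b 2) :
    MemLp (conv a b) 2 :=
  ⟨aestronglyMeasurable_conv ha.1 hb.1, (eLpNorm_conv_le ha.1 hb.1).trans_lt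
    (ENNReal.mul_lt_top ha.2 hb.2)⟩

theorem integrable_conv {a b : Rd d → ℂ} (ha : Integrable a) (hb : Integrable b) :
    Integrable (conv a b) :=
  ha.integrable_convolution (ContinuousLinearMap.mul ℂ ℂ) hb

theorem conv_add_ae {a b c : Rd d → ℂ} (ha : Integrable a) (hb : MemLp b 2) (hc : MemLp c 2) :
    conv a (b + c) =ᵐ[volume] conv a b + conv a c := by
  filter_upwards [ae_convolutionExistsAt ha hb, ae_convolutionExistsAt ha hc] with ξ h1 h2
  simp only [conv_apply, Pi.add_apply, mul_add]
  exact integral_add h1 h2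

theorem fourierInv_conv {a b : Rd d → ℂ} (ha : Integrable a) (hb : Integrable b) (x : Rd d) :
    𝓕⁻ (conv a b) x = 𝓕⁻ a x * 𝓕⁻ b x := by
  simp only [Real.fourierInv_eq_fourier_neg]
  exact Real.fourier_mul_convolution_eq ha hb (-x)

end Convolution

/-! ### Plancherel and convolution operators on `L²` -/

section Fourier
variable {d : ℕ}

theorem integral_fourierInv_smul_eq {g k : Rd d → ℂ} (hg : Integrable g) (hk : Integrable k) :
    ∫ x, 𝓕⁻ g x • k x = ∫ x, g x • 𝓕⁻ k x := by
  have h := VectorFourier.integral_fourierIntegral_smul_eq_flip (L := -innerₗ (Rd d))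
    (μ := volume) (ν := volume) Real.continuous_fourierChar continuous_inner.neg
    hg hk
  have hf : (-innerₗ (Rd d)).flip = -innerₗ (Rd d) := by
    ext x y
    simp [real_inner_comm]
  rw [hf] at h
  exact h

/-- On `L¹ ∩ L²` the inverse Fourier–Plancherel transform is the inverse Fourier integral. -/
theorem fourierInv_toLp_ae_eq {k : Rd d → ℂ} (h1 : Integrable k) (h2 : MemLp k 2) :
    (𝓕⁻ (h2.toLp k) : L2 d) =ᵐ[volume] 𝓕⁻ k := by
  have hcont : Continuous (𝓕⁻ k) := by
    rw [Real.fourierInv_eq_fourier_comp_neg]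
    exact VectorFourier.fourierIntegral_continuous Real.continuous_fourierChar
      continuous_inner h1.comp_neg
  refine ae_eq_of_integral_contDiff_smul_eq ((Lp.memLp _).locallyIntegrable (by norm_num))
    hcont.locallyIntegrable fun g hg hgc => ?_
  have hg₁ : HasCompactSupport (Complex.ofRealCLM ∘ g) := hgc.comp_left rfl
  have hg₂ : ContDiff ℝ ∞ (Complex.ofRealCLM ∘ g) := by fun_prop
  set G : 𝓢(Rd d, ℂ) := hg₁.toSchwartzMap hg₂
  have hG : ∀ x, G x = (g x : ℂ) := fun x => rfl
  have h3 := congrArg (fun T : 𝓢'(Rd d, ℂ) => T G)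
    (Lp.fourierInv_toTemperedDistribution_eq (h2.toLp k))
  simp only [TemperedDistribution.fourierInv_apply, Lp.toTemperedDistribution_apply] at h3
  calc ∫ x, g x • (𝓕⁻ (h2.toLp k) : L2 d) x = ∫ x, G x • (𝓕⁻ (h2.toLp k) : L2 d) x := by
        simp [hG]
    _ = ∫ x, 𝓕⁻ G x • k x := by
        rw [← h3]
        refine integral_congr_ae ?_
        filter_upwards [h2.coeFn_toLp] with x hx
        rw [hx]
    _ = ∫ x, G x • 𝓕⁻ k x := by
        rw [SchwartzMap.fourierInv_coe]
        exact integral_fourierInv_smul_eq G.integrable h1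
    _ = _ := by simp [hG]

theorem eLpNorm_fourierInv {k : Rd d → ℂ} (h1 : Integrable k) (h2 : MemLp k 2) :
    eLpNorm (𝓕⁻ k) 2 volume = eLpNorm k 2 volume := by
  rw [← eLpNorm_congr_ae (fourierInv_toLp_ae_eq h1 h2), ← eLpNorm_congr_ae h2.coeFn_toLp,
    ← Lp.enorm_def, ← Lp.enorm_def]
  simp only [enorm_eq_nnnorm, ← NNReal.coe_inj, ENNReal.coe_inj, coe_nnnorm]
  rw [← Lp.norm_fourier_eq, FourierTransform.fourier_fourierInv_eq]

theorem fourierInv_add_const_mul {k l : Rd d → ℂ} (hk : Integrable k) (hl : Integrable l)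
    (c : ℂ) (x : Rd d) : 𝓕⁻ (fun ξ => c * k ξ + l ξ) x = c * 𝓕⁻ k x + 𝓕⁻ l x := by
  simp only [Real.fourierInv_eq]
  have h1 : ∀ m : Rd d → ℂ, Integrable m → Integrable fun v => Real.fourierChar (inner ℝ v x) • m v :=
    fun m hm => by
      simpa using (Real.fourierIntegral_convergent_iff (-x)).2 hm
  rw [← integral_const_mul, ← integral_add ((h1 k hk).const_mul c) (h1 l hl)]
  refine integral_congr_ae (Filter.Eventually.of_forall fun v => ?_)
  simp only [Circle.smul_def, smul_eq_mul]
  ring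

/-- The inverse Fourier transform turns the operator into multiplication by `c + 𝓕⁻ a`, and
Plancherel preserves both norms. -/
theorem eLpNorm_multiplier_le_of_integrable {a h : Rd d → ℂ} {c : ℂ} {M : ℝ≥0}
    (ha : Integrable a) (hM : ∀ x, ‖c + 𝓕⁻ a x‖ ≤ M) (h1 : Integrable h) (h2 : MemLp h 2) :
    eLpNorm (fun ξ => c * h ξ + conv a h ξ) 2 volume ≤ M * eLpNorm h 2 volume := by
  rw [← eLpNorm_fourierInv (k := fun ξ => c * h ξ + conv a h ξ)
      ((h1.const_mul c).add (integrable_conv ha h1))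
    ((h2.const_mul c).add (memLp_conv ha h2)), ← eLpNorm_fourierInv h1 h2]
  refine eLpNorm_le_nnreal_smul_eLpNorm_of_ae_le_mul (Filter.Eventually.of_forall fun x => ?_) 2
  rw [fourierInv_add_const_mul h1 (integrable_conv ha h1), fourierInv_conv ha h1, ← add_mul,
    nnnorm_mul]
  gcongr
  exact hM x

/-- If `c + 𝓕⁻ a` is bounded by `M`, then `h ↦ c h + a ⋆ h` has norm at most `M` on `L²`. -/
theorem eLpNorm_multiplier_le {a h : Rd d → ℂ} {c : ℂ} {M : ℝ≥0}
    (ha : Integrable a) (hM : ∀ x, ‖c + 𝓕⁻ a x‖ ≤ M) (h2 : MemLp h 2) :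
    eLpNorm (fun ξ => c * h ξ + conv a h ξ) 2 volume ≤ M * eLpNorm h 2 volume := by
  set A : ℝ≥0∞ := ∫⁻ x, ‖a x‖ₑ with hA
  set K : ℝ≥0∞ := ‖c‖ₑ + A + M with hK
  have hKtop : K ≠ ⊤ := by
    simp only [hK, ne_eq, ENNReal.add_eq_top, not_or]
    exact ⟨⟨by simp, ha.2.ne⟩, by simp⟩
  -- Approximate `h` in `L²` by continuous compactly supported `g`, which is integrable; Young's
  -- inequality controls the remainder `h - g`, with a constant not yet sharp but multiplied by `ε`.
  have key : ∀ ε : ℝ≥0∞, ε ≠ 0 → eLpNorm (fun ξ => c * h ξ + conv a h ξ) 2 volume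
      ≤ M * eLpNorm h 2 volume + K * ε := fun ε hε => by
    obtain ⟨g, hgc, hgε, hgcont, hg2⟩ :=
      h2.exists_hasCompactSupport_eLpNorm_sub_le (by norm_num) hε
    have hg1 : Integrable g := hgcont.integrable_of_hasCompactSupport hgc
    have hr2 : MemLp (h - g) 2 := h2.sub hg2
    have e : (fun ξ => c * h ξ + conv a h ξ) =ᵐ[volume]
        (fun ξ => c * g ξ + conv a g ξ) + ((fun ξ => c * (h - g) ξ) + conv a (h - g)) := by
      have h3 := conv_add_ae ha hg2 hr2
      rw [add_sub_cancel] at h3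
      filter_upwards [h3] with ξ hξ
      simp only [hξ, Pi.add_apply, Pi.sub_apply]
      ring
    rw [eLpNorm_congr_ae e]
    have m1 := ((hg2.const_mul c).add (memLp_conv ha hg2)).1
    have m2 := (hr2.const_mul c).1
    have m3 := (memLp_conv ha hr2).1
    have n1 := eLpNorm_multiplier_le_of_integrable ha hM hg1 hg2
    have n2 : eLpNorm (fun ξ => c * (h - g) ξ) 2 volume ≤ ‖c‖ₑ * ε := by
      have := eLpNorm_const_smul_le (c := c) (f := h - g) (p := 2) (μ := volume)
      exact this.trans (by gcongr)
    have n3 : eLpNorm (conv a (h - g)) 2 volume ≤ A * ε :=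
      (eLpNorm_conv_le ha.1 hr2.1).trans (by gcongr)
    have n4 : eLpNorm g 2 volume ≤ eLpNorm h 2 volume + ε := by
      have : g = h - (h - g) := by simp
      rw [this]
      exact (eLpNorm_sub_le h2.1 hr2.1 (by norm_num)).trans (by gcongr)
    calc _ ≤ _ := eLpNorm_add_le m1 (m2.add m3) (by norm_num)
      _ ≤ _ := add_le_add le_rfl (eLpNorm_add_le m2 m3 (by norm_num))
      _ ≤ M * (eLpNorm h 2 volume + ε) + (‖c‖ₑ * ε + A * ε) := by
        gcongr
        exact n1.trans (by gcongr)
      _ = _ := by rw [hK]; ring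
  refine ENNReal.le_of_forall_pos_le_add fun ε hε _ => ?_
  have hK1 : K + 1 ≠ ⊤ := by simp [hKtop]
  refine (key (ε / (K + 1)) (by simp [hε.ne', hKtop])).trans ?_
  gcongr
  rw [← mul_div_assoc, mul_comm]
  refine ENNReal.div_le_of_le_mul ?_
  gcongr
  exact le_self_add

end Fourier

/-! ### The commutator estimate -/

section Commutator
variable {d : ℕ}

/-- The commutator of `(1 + |ξ|²)^{s/2}` with convolution. -/
theorem exists_lintegral_commutator_le {s ρ : ℝ} (hs : 0 < s) (hsρ : s - 1 ≤ ρ)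
    (hρ : (d : ℝ) / 2 < ρ) :
    ∃ C : ℝ≥0, ∀ A B : Rd d → ℝ≥0∞, AEMeasurable A → AEMeasurable B →
      eLpNorm (fun ξ => ∫⁻ t, A t * (‖weight s ξ - weight s (-t + ξ)‖ₑ * B (-t + ξ))) 2 volume ≤
        C * eLpNorm (fun ξ => ‖weight s ξ‖ₑ * A ξ) 2 volume *
          eLpNorm (fun ξ => ‖weight ρ ξ‖ₑ * B ξ) 2 volume := by
  obtain ⟨C, hC, h⟩ := exists_abs_weight_sub_le d hs hsρ
  have hw := memLp_weight_neg hρ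
  set N : ℝ≥0∞ := eLpNorm (weight (-ρ) : Rd d → ℝ) 2 volume with hN
  have hNtop : N ≠ ⊤ := hw.2.ne
  have hN' : eLpNorm (fun ξ : Rd d => ‖weight (-ρ) ξ‖ₑ) 2 volume = N := by rw [eLpNorm_enorm]
  refine ⟨‖C‖₊ * (2 * N.toNNReal), fun A B hA hB => ?_⟩
  have hm : ∀ r : ℝ, Measurable fun ξ : Rd d => ‖weight r ξ‖ₑ := fun r =>
    (measurable_weight r).enorm
  set P : Rd d → ℝ≥0∞ := fun ξ => ‖weight s ξ‖ₑ * A ξ with hP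
  set Q : Rd d → ℝ≥0∞ := fun ξ => ‖weight ρ ξ‖ₑ * B ξ with hQ
  have hPm : AEMeasurable P := (hm s).aemeasurable.mul hA
  have hQm : AEMeasurable Q := (hm ρ).aemeasurable.mul hB
  set P' : Rd d → ℝ≥0∞ := fun ξ => ‖weight (-ρ) ξ‖ₑ * P ξ with hP'
  set Q' : Rd d → ℝ≥0∞ := fun ξ => ‖weight (-ρ) ξ‖ₑ * Q ξ with hQ'
  have hPm' : AEMeasurable P' := (hm (-ρ)).aemeasurable.mul hPm
  have hQm' : AEMeasurable Q' := (hm (-ρ)).aemeasurable.mul hQm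
  -- The two summands of the weight bound place the factor of order `-ρ` on `B` and on `A`
  -- respectively.
  have hpt : ∀ ξ, (∫⁻ t, A t * (‖weight s ξ - weight s (-t + ξ)‖ₑ * B (-t + ξ))) ≤
      ‖C‖₊ * (Q' ⋆ₗ P + P' ⋆ₗ Q) ξ := fun ξ => by
    rw [Pi.add_apply, lconvolution_comm (f := Q'), lconvolution_def, lconvolution_def,
      ← lintegral_add_left', ← lintegral_const_mul' _ _ (by simp)]
    · refine lintegral_mono fun t => ?_
      have h1 := h ξ (-t + ξ)
      have e1 : ξ - (-t + ξ) = t := by abel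
      rw [e1, ← Real.norm_eq_abs] at h1
      have h2 : ‖weight s ξ - weight s (-t + ξ)‖ₑ ≤ ‖C‖₊ * (‖weight s t‖ₑ * ‖weight ρ (-t + ξ)‖ₑ *
          (‖weight (-ρ) (-t + ξ)‖ₑ + ‖weight (-ρ) t‖ₑ)) := by
        have h3 := ENNReal.ofReal_le_ofReal h1
        rw [ENNReal.ofReal_mul hC, ENNReal.ofReal_mul
          (mul_nonneg (weight_pos _ _).le (weight_pos _ _).le),
          ENNReal.ofReal_mul (weight_pos _ _).le,
          ENNReal.ofReal_add (weight_pos _ _).le (weight_pos _ _).le] at h3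
        simp only [← enorm_eq_nnnorm, Real.enorm_of_nonneg hC,
          Real.enorm_of_nonneg (weight_pos _ _).le]
        rwa [ofReal_norm] at h3
      calc A t * (‖weight s ξ - weight s (-t + ξ)‖ₑ * B (-t + ξ)) ≤ A t * ((‖C‖₊ *
            (‖weight s t‖ₑ * ‖weight ρ (-t + ξ)‖ₑ *
            (‖weight (-ρ) (-t + ξ)‖ₑ + ‖weight (-ρ) t‖ₑ))) * B (-t + ξ)) := by gcongr
        _ = _ := by simp only [hP, hQ, hP', hQ']; ring
    · exact hPm.mul (hQm'.comp_quasiMeasurePreserving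
        (by simpa [neg_add_eq_sub] using
          quasiMeasurePreserving_sub_left_of_right_invariant volume ξ))
  -- Cauchy–Schwarz against the weight of order `-ρ` puts `Q'` and `P'` in `L¹`, so Young's
  -- inequality applies.
  have hc1 : ∫⁻ x, Q' x ≤ N * eLpNorm Q 2 volume :=
    (lintegral_mul_le_eLpNorm_two (hm (-ρ)).aemeasurable hQm).trans_eq (by rw [hN'])
  have hc2 : ∫⁻ x, P' x ≤ N * eLpNorm P 2 volume :=
    (lintegral_mul_le_eLpNorm_two (hm (-ρ)).aemeasurable hPm).trans_eq (by rw [hN'])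
  calc _ ≤ eLpNorm (fun ξ => ‖C‖₊ * (Q' ⋆ₗ P + P' ⋆ₗ Q) ξ) 2 volume :=
        eLpNorm_mono_enorm fun ξ => by simpa using hpt ξ
    _ ≤ ‖C‖₊ * eLpNorm (Q' ⋆ₗ P + P' ⋆ₗ Q) 2 volume :=
        eLpNorm_le_nnreal_smul_eLpNorm_of_ae_le_mul' (Filter.Eventually.of_forall fun ξ => by
          simp) 2
    _ ≤ ‖C‖₊ * (eLpNorm (Q' ⋆ₗ P) 2 volume + eLpNorm (P' ⋆ₗ Q) 2 volume) := by
        gcongr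
        exact eLpNorm_add_le (aemeasurable_lconvolution hQm' hPm).aestronglyMeasurable
          (aemeasurable_lconvolution hPm' hQm).aestronglyMeasurable (by norm_num)
    _ ≤ ‖C‖₊ * ((∫⁻ x, Q' x) * eLpNorm P 2 volume + (∫⁻ x, P' x) * eLpNorm Q 2 volume) := by
        gcongr
        · exact eLpNorm_lconvolution_le hQm' hPm
        · exact eLpNorm_lconvolution_le hPm' hQm
    _ ≤ ‖C‖₊ * ((N * eLpNorm Q 2 volume) * eLpNorm P 2 volume +
          (N * eLpNorm P 2 volume) * eLpNorm Q 2 volume) := by gcongr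
    _ = _ := by
        push_cast
        rw [ENNReal.coe_toNNReal hNtop]
        ring

end Commutator

/-! ### Interpolation and the weighted product estimate -/

section Multiplier
variable {d : ℕ}

/-- At high frequencies `ε⟨ξ⟩^{s-ρ} ≥ 1` and the first term suffices. Otherwise `⟨ξ⟩^{s-ρ} ≤ ε⁻¹`,
and `ρ ≤ m (s - ρ)` bounds the weight by `ε⁻¹ ^ m`. -/
theorem exists_weight_le {s ρ : ℝ} (hρs : ρ < s) :
    ∃ m : ℕ, ∀ ε : ℝ, 0 < ε → ∀ ξ : Rd d, weight ρ ξ ≤ ε * weight s ξ + ε⁻¹ ^ m := by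
  obtain ⟨m, hm⟩ := exists_nat_ge (ρ / (s - ρ))
  have hsub : 0 < s - ρ := sub_pos.2 hρs
  refine ⟨m, fun ε hε ξ => ?_⟩
  have h1 : weight s ξ = weight (s - ρ) ξ * weight ρ ξ := by rw [weight_mul]; ring_nf
  have hp := weight_pos ρ ξ
  have hq := weight_pos (s - ρ) ξ
  rcases le_total 1 (ε * weight (s - ρ) ξ) with h | h
  · rw [h1]
    have : 0 < ε⁻¹ ^ m := by positivity
    nlinarith
  · have h2 : weight (s - ρ) ξ ≤ ε⁻¹ := by
      rw [← one_div, le_div_iff₀ hε]; linarith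
    have h3 : weight ρ ξ ≤ weight (s - ρ) ξ ^ m := by
      rw [← weight_one_rpow (s - ρ), ← Real.rpow_natCast, ← Real.rpow_mul (weight_pos 1 ξ).le,
        weight_one_rpow]
      refine weight_mono ?_ ξ
      rw [div_le_iff₀ hsub] at hm
      linarith
    have h4 := pow_le_pow_left₀ hq.le h2 m
    have : 0 < ε * weight s ξ := mul_pos hε (weight_pos s ξ)
    linarith

theorem memLp_of_memLp_weight {s : ℝ} (hs : 0 ≤ s) {a : Rd d → ℂ} (ha : AEStronglyMeasurable a)
    (h : MemLp (fun ξ => (weight s ξ : ℂ) * a ξ) 2) : MemLp a 2 := by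
  refine h.mono ha (Filter.Eventually.of_forall fun ξ => ?_)
  rw [norm_mul, Complex.norm_real, Real.norm_of_nonneg (weight_pos s ξ).le]
  exact le_mul_of_one_le_left (norm_nonneg _) (one_le_weight hs ξ)

theorem eLpNorm_weight_mul (r : ℝ) (a : Rd d → ℂ) :
    eLpNorm (fun ξ => (weight r ξ : ℂ) * a ξ) 2 volume =
      eLpNorm (fun ξ => ‖weight r ξ‖ₑ * ‖a ξ‖ₑ) 2 volume :=
  eLpNorm_congr_enorm_ae (Filter.Eventually.of_forall fun ξ => by
    simp [enorm_eq_nnnorm])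

theorem lintegral_enorm_le_of_weight {s : ℝ} {a : Rd d → ℂ} (ha : AEStronglyMeasurable a) :
    ∫⁻ ξ, ‖a ξ‖ₑ ≤ eLpNorm (weight (-s) : Rd d → ℝ) 2 volume *
      eLpNorm (fun ξ => (weight s ξ : ℂ) * a ξ) 2 volume := by
  have h := lintegral_mul_le_eLpNorm_two (p := fun ξ : Rd d => ‖weight (-s) ξ‖ₑ)
    (q := fun ξ => ‖weight s ξ‖ₑ * ‖a ξ‖ₑ) (measurable_weight (-s)).enorm.aemeasurable
    ((measurable_weight s).enorm.aemeasurable.mul ha.enorm)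
  rw [eLpNorm_enorm, ← eLpNorm_weight_mul] at h
  refine le_trans (le_of_eq (lintegral_congr fun ξ => ?_)) h
  rw [← mul_assoc, ← enorm_mul, weight_neg_mul]
  simp

theorem integrable_of_memLp_weight {s : ℝ} (hs : (d : ℝ) / 2 < s) {a : Rd d → ℂ}
    (ha : AEStronglyMeasurable a) (h : MemLp (fun ξ => (weight s ξ : ℂ) * a ξ) 2) :
    Integrable a :=
  ⟨ha, (lintegral_enorm_le_of_weight ha).trans_lt
    (ENNReal.mul_lt_top (memLp_weight_neg hs).2 h.2)⟩

/-- Moving the weight past the convolution onto `b` leaves the multiplier `c + 𝓕⁻ a` acting on the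
weighted `b`, of norm at most `M`; the error is the commutator. That `M` carries no constant is what
permits iteration. -/
theorem eLpNorm_weight_conv_le {s ρ : ℝ} (hs : (d : ℝ) / 2 < s) (hsρ : s - 1 ≤ ρ)
    (hρ : (d : ℝ) / 2 < ρ) :
    ∃ C : ℝ≥0, ∀ a b : Rd d → ℂ, AEStronglyMeasurable a → AEStronglyMeasurable b →
      MemLp (fun ξ => (weight s ξ : ℂ) * a ξ) 2 → MemLp (fun ξ => (weight s ξ : ℂ) * b ξ) 2 →
      ∀ (c : ℂ) (M : ℝ≥0), (∀ x, ‖c + 𝓕⁻ a x‖ ≤ M) →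
      eLpNorm (fun ξ => (weight s ξ : ℂ) * (c * b ξ + conv a b ξ)) 2 volume ≤
        M * eLpNorm (fun ξ => (weight s ξ : ℂ) * b ξ) 2 volume +
        C * eLpNorm (fun ξ => (weight s ξ : ℂ) * a ξ) 2 volume *
          eLpNorm (fun ξ => (weight ρ ξ : ℂ) * b ξ) 2 volume := by
  have hs0 : 0 < s := lt_of_le_of_lt (by positivity) hs
  obtain ⟨C, h⟩ := exists_lintegral_commutator_le hs0 hsρ hρ
  refine ⟨C, fun a b ham hbm ha hb c M hM => ?_⟩
  have ha1 := integrable_of_memLp_weight hs ham ha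
  have hb2 := memLp_of_memLp_weight hs0.le hbm hb
  set F : Rd d → ℂ := fun ξ => c * ((weight s ξ : ℂ) * b ξ) +
    conv a (fun ξ => (weight s ξ : ℂ) * b ξ) ξ with hF
  set G : Rd d → ℂ := fun ξ => (weight s ξ : ℂ) * (c * b ξ + conv a b ξ) with hG
  have hwm : AEStronglyMeasurable (fun ξ : Rd d => (weight s ξ : ℂ)) :=
    (Complex.continuous_ofReal.comp (continuous_weight s)).aestronglyMeasurable
  have hFm : AEStronglyMeasurable F :=
    ((hb.const_mul c).add (memLp_conv ha1 hb)).1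
  have hGm : AEStronglyMeasurable G :=
    hwm.mul ((hb2.const_mul c).add (memLp_conv ha1 hb2)).1
  have hdiff : eLpNorm (G - F) 2 volume ≤ C * eLpNorm (fun ξ => (weight s ξ : ℂ) * a ξ) 2 volume *
      eLpNorm (fun ξ => (weight ρ ξ : ℂ) * b ξ) 2 volume := by
    rw [eLpNorm_weight_mul, eLpNorm_weight_mul]
    refine le_trans (eLpNorm_mono_enorm_ae ?_) (h _ _ ham.enorm hbm.enorm)
    filter_upwards [ae_convolutionExistsAt ha1 hb, ae_convolutionExistsAt ha1 hb2] with ξ h1 h2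
    have e : (G - F) ξ = ∫ t, a t * (((weight s ξ - weight s (-t + ξ) : ℝ) : ℂ) * b (-t + ξ)) := by
      simp only [hG, hF, Pi.sub_apply, conv_apply]
      rw [show ∀ A B D E : ℂ, A * (c * B + D) - (c * (A * B) + E) = A * D - E by intros; ring,
        ← integral_const_mul, ← integral_sub (h2.const_mul _) h1]
      refine integral_congr_ae (Filter.Eventually.of_forall fun t => ?_)
      simp only [neg_add_eq_sub]
      push_cast
      ring
    rw [e, enorm_eq_self]
    refine (enorm_integral_le_lintegral_enorm _).trans_eq (lintegral_congr fun t => ?_)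
    rw [enorm_mul, enorm_mul]
    simp [enorm_eq_nnnorm, -Complex.ofReal_sub]
  calc eLpNorm G 2 volume = eLpNorm (F + (G - F)) 2 volume := by rw [add_sub_cancel]
    _ ≤ eLpNorm F 2 volume + eLpNorm (G - F) 2 volume :=
        eLpNorm_add_le hFm (hGm.sub hFm) (by norm_num)
    _ ≤ _ := add_le_add (eLpNorm_multiplier_le ha1 hM hb) hdiff

end Multiplier

/-! ### The space `H^s` on the Fourier side -/

namespace Hs
variable {d : ℕ} {s : ℝ}

/-- The Fourier transform of `u`, as a function. -/
def hat (u : Hs d s) : Rd d → ℂ := ⇑(𝓕 u.toL2 : L2 d)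

theorem aestronglyMeasurable_hat (u : Hs d s) : AEStronglyMeasurable u.hat :=
  Lp.aestronglyMeasurable _

theorem memLp_weight_hat (u : Hs d s) : MemLp (fun ξ => (weight s ξ : ℂ) * u.hat ξ) 2 := u.2

theorem enorm_eq (u : Hs d s) :
    ‖u‖ₑ = eLpNorm (fun ξ => (weight s ξ : ℂ) * u.hat ξ) 2 volume := by
  rw [← ofReal_norm, Hs.norm_eq]
  exact ENNReal.ofReal_toReal u.2.2.ne

theorem enorm_toL2 (u : Hs d s) : ‖u.toL2‖ₑ = eLpNorm u.hat 2 volume := by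
  rw [hat, ← Lp.enorm_def, ← ofReal_norm, ← ofReal_norm, Lp.norm_fourier_eq]

theorem hat_add (u v : Hs d s) : (u + v).hat =ᵐ[volume] u.hat + v.hat := by
  have h : (𝓕 (u + v).toL2 : L2 d) = 𝓕 u.toL2 + 𝓕 v.toL2 := by
    rw [map_add]; exact FourierTransform.fourier_add _ _
  rw [hat, h]
  exact Lp.coeFn_add _ _

theorem hat_smul (c : ℂ) (u : Hs d s) : (c • u).hat =ᵐ[volume] c • u.hat := by
  have h : (𝓕 (c • u).toL2 : L2 d) = c • 𝓕 u.toL2 := by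
    rw [map_smul]; exact FourierTransform.fourier_smul _ _
  rw [hat, h]
  exact Lp.coeFn_smul _ _

theorem toL2_injective : Function.Injective (toL2 : Hs d s →ₗ[ℂ] L2 d) := Subtype.val_injective

theorem exists_hat_eq (hs : 0 ≤ s) {a : Rd d → ℂ} (ha : AEStronglyMeasurable a)
    (h : MemLp (fun ξ => (weight s ξ : ℂ) * a ξ) 2) : ∃ u : Hs d s, u.hat =ᵐ[volume] a := by
  have h2 := memLp_of_memLp_weight hs ha h
  have e : (𝓕 (𝓕⁻ (h2.toLp a) : L2 d) : L2 d) =ᵐ[volume] a := by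
    rw [FourierTransform.fourier_fourierInv_eq]
    exact h2.coeFn_toLp
  refine ⟨⟨𝓕⁻ (h2.toLp a), h.ae_eq ?_⟩, e⟩
  filter_upwards [e] with ξ hξ
  simp only [weightedFourierFun, hξ, weight]

theorem norm_toL2_le (hs : 0 ≤ s) (u : Hs d s) : ‖u.toL2‖ ≤ ‖u‖ := by
  rw [← ENNReal.ofReal_le_ofReal_iff (norm_nonneg _), ofReal_norm, ofReal_norm, enorm_toL2, enorm_eq]
  refine eLpNorm_mono fun ξ => ?_
  rw [norm_mul, Complex.norm_real, Real.norm_of_nonneg (weight_pos s ξ).le]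
  exact le_mul_of_one_le_left (norm_nonneg _) (one_le_weight hs ξ)

/-- The isometry `u ↦ (1 + |ξ|²)^{s/2} û` is onto `L²`. Completeness serves the exponential series
and the Bochner integral below. -/
theorem completeSpace (hs : 0 ≤ s) : CompleteSpace (Hs d s) := by
  have hiso : Isometry (Hs.weightedFourier d s) :=
    AddMonoidHomClass.isometry_of_norm _ fun _ => rfl
  refine (hiso.isUniformInducing.completeSpace_congr fun g => ?_).2 inferInstance
  have hcont : Continuous fun ξ : Rd d => ((weight (-s) ξ : ℝ) : ℂ) :=
    Complex.continuous_ofReal.comp (continuous_weight (-s))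
  have hg : (fun ξ => (weight s ξ : ℂ) * ((weight (-s) ξ : ℂ) * g ξ)) = g := by
    ext ξ
    rw [← mul_assoc, ← Complex.ofReal_mul, mul_comm (weight s ξ), weight_neg_mul]
    simp
  obtain ⟨u, hu⟩ := exists_hat_eq hs
    (hcont.aestronglyMeasurable.mul (Lp.aestronglyMeasurable g)) (by
      have := Lp.memLp g
      rw [← hg] at this
      exact this)
  refine ⟨u, Lp.ext ((MemLp.coeFn_toLp u.2).trans ?_)⟩
  filter_upwards [hu] with ξ hξ
  exact (congrArg ((weight s ξ : ℂ) * ·) hξ).trans (congrFun hg ξ)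

/-! ### Embedding into bounded functions and point evaluation -/

section Eval
variable [hs : Fact ((d : ℝ) / 2 < s)]

omit hs in
theorem order_pos (hs : (d : ℝ) / 2 < s) : 0 < s := lt_of_le_of_lt (by positivity) hs

instance : CompleteSpace (Hs d s) := completeSpace (order_pos hs.out).le

theorem integrable_hat (u : Hs d s) : Integrable u.hat :=
  integrable_of_memLp_weight hs.out u.aestronglyMeasurable_hat u.memLp_weight_hat

omit hs in
theorem memLp_hat (u : Hs d s) : MemLp u.hat 2 := Lp.memLp _

variable (d s) in
/-- The norm of the embedding of `H^s` into the bounded functions. -/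
def embeddingConst : ℝ := (eLpNorm (weight (-s) : Rd d → ℝ) 2 volume).toReal

omit hs in
theorem embeddingConst_nonneg : 0 ≤ embeddingConst d s := ENNReal.toReal_nonneg

theorem norm_fourierInv_hat_le (u : Hs d s) (x : Rd d) :
    ‖𝓕⁻ u.hat x‖ ≤ embeddingConst d s * ‖u‖ := by
  rw [Real.fourierInv_eq]
  have h : ‖∫ v, Real.fourierChar (inner ℝ v x) • u.hat v‖ₑ ≤
      eLpNorm (weight (-s) : Rd d → ℝ) 2 volume * ‖u‖ₑ := by
    refine (enorm_integral_le_lintegral_enorm _).trans ?_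
    rw [enorm_eq]
    refine le_trans (le_of_eq (lintegral_congr fun v => ?_))
      (lintegral_enorm_le_of_weight (s := s) u.aestronglyMeasurable_hat)
    rw [← ofReal_norm, ← ofReal_norm, Circle.norm_smul]
  have h2 := ENNReal.toReal_mono
    (ENNReal.mul_lt_top (memLp_weight_neg hs.out).2 enorm_lt_top).ne h
  simpa [embeddingConst] using h2

/-- Evaluation of the continuous representative of `u` at `x`. -/
def ev (x : Rd d) : Hs d s →L[ℂ] ℂ :=
  LinearMap.mkContinuous
    { toFun := fun u => 𝓕⁻ u.hat x
      map_add' := fun u v => by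
        rw [Real.fourierInv_congr_ae (hat_add u v)]
        have := fourierInv_add_const_mul u.integrable_hat v.integrable_hat 1 x
        simp only [one_mul] at this
        exact this
      map_smul' := fun c u => by
        rw [Real.fourierInv_congr_ae (hat_smul c u)]
        simp only [Real.fourierInv_eq, Pi.smul_apply, RingHom.id_apply]
        rw [← integral_smul]
        refine integral_congr_ae (Filter.Eventually.of_forall fun v => ?_)
        simp only [Circle.smul_def, smul_eq_mul]
        ring }
    (embeddingConst d s) fun u => norm_fourierInv_hat_le u x

theorem ev_apply (x : Rd d) (u : Hs d s) : ev x u = 𝓕⁻ u.hat x := rfl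

theorem norm_ev_le (x : Rd d) (u : Hs d s) : ‖ev x u‖ ≤ embeddingConst d s * ‖u‖ :=
  norm_fourierInv_hat_le u x

theorem toL2_ae_eq (u : Hs d s) : u.toL2 =ᵐ[volume] fun x => ev x u := by
  have h := fourierInv_toLp_ae_eq u.integrable_hat u.memLp_hat
  have e : u.memLp_hat.toLp u.hat = (𝓕 u.toL2 : L2 d) := Lp.toLp_coeFn _ _
  rwa [e, FourierTransform.fourierInv_fourier_eq] at h

theorem ext_ev {u v : Hs d s} (h : ∀ x, ev x u = ev x v) : u = v := by
  refine toL2_injective (Lp.ext ?_)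
  filter_upwards [toL2_ae_eq u, toL2_ae_eq v] with x h1 h2
  rw [h1, h2, h]

/-- Conjugating a function replaces its Fourier transform by the conjugate of its reflection, and
the weight is even. -/
theorem exists_conj (u : Hs d s) :
    ∃ v : Hs d s, ‖v‖ = ‖u‖ ∧ ∀ x, ev x v = starRingEnd ℂ (ev x u) := by
  set a : Rd d → ℂ := fun ξ => starRingEnd ℂ (u.hat (-ξ)) with ha
  have hmp := Measure.measurePreserving_neg (volume : Measure (Rd d))
  have ham : AEStronglyMeasurable a :=
    Complex.continuous_conj.comp_aestronglyMeasurable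
      (u.aestronglyMeasurable_hat.comp_measurePreserving hmp)
  have hnorm : ∀ ξ, ‖(weight s ξ : ℂ) * a ξ‖ₑ = ‖(weight s (-ξ) : ℂ) * u.hat (-ξ)‖ₑ := fun ξ => by
    simp [ha, weight_neg, enorm_eq_nnnorm]
  have hcont : Continuous fun ξ : Rd d => ((weight s ξ : ℝ) : ℂ) :=
    Complex.continuous_ofReal.comp (continuous_weight s)
  have heL : eLpNorm (fun ξ => (weight s ξ : ℂ) * a ξ) 2 volume = ‖u‖ₑ := by
    rw [enorm_eq, ← eLpNorm_comp_measurePreserving u.memLp_weight_hat.1 hmp]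
    exact eLpNorm_congr_enorm_ae (Filter.Eventually.of_forall hnorm)
  obtain ⟨v, hv⟩ := exists_hat_eq (order_pos hs.out).le ham
    ⟨hcont.aestronglyMeasurable.mul ham, by rw [heL]; exact enorm_lt_top⟩
  refine ⟨v, ?_, fun x => ?_⟩
  · have h1 : ‖v‖ₑ = ‖u‖ₑ := by
      rw [← heL, enorm_eq]
      refine eLpNorm_congr_ae ?_
      filter_upwards [hv] with ξ hξ
      rw [hξ]
    simpa [enorm_eq_nnnorm, ← NNReal.coe_inj] using h1
  · rw [ev_apply, ev_apply, Real.fourierInv_congr_ae hv, Real.fourierInv_eq, Real.fourierInv_eq,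
      ← integral_conj, ← integral_neg_eq_self]
    refine integral_congr_ae (Filter.Eventually.of_forall fun v => ?_)
    simp only [ha, Circle.smul_def, smul_eq_mul, neg_neg, map_mul, inner_neg_left,
      AddChar.map_neg_eq_inv, Circle.coe_inv_eq_conj]

end Eval

/-! ### The product estimate in `H^s` -/

section Mul
variable [hs : Fact ((d : ℝ) / 2 < s)]

variable (d s) in
/-- `H^s` is closed under products, and multiplication by a bounded function `c + φ` is bounded on
`H^s` by the supremum norm of this function, up to a term of lower order. -/
theorem exists_mul : ∃ C : ℝ, 0 ≤ C ∧ ∃ m : ℕ, ∀ φ u : Hs d s, ∃ p : Hs d s,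
    (∀ x, ev x p = ev x φ * ev x u) ∧
    ∀ (c : ℂ) (M : ℝ), (∀ x, ‖c + ev x φ‖ ≤ M) → ∀ ε : ℝ, 0 < ε →
      ‖c • u + p‖ ≤ M * ‖u‖ + C * ‖φ‖ * (ε * ‖u‖ + ε⁻¹ ^ m * ‖u.toL2‖) := by
  have hs' := hs.out
  have hs0 := order_pos hs'
  -- The commutator needs `ρ > d/2` and `ρ ≥ s - 1`; interpolation needs `ρ < s`.
  set ρ : ℝ := max ((d / 2 + s) / 2) (s - 1) with hρdef
  have hρ : (d : ℝ) / 2 < ρ := lt_max_of_lt_left (by linarith)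
  have hρs : ρ < s := max_lt (by linarith) (by linarith)
  obtain ⟨C, hC⟩ := eLpNorm_weight_conv_le hs' (le_max_right _ _ : s - 1 ≤ ρ) hρ
  obtain ⟨m, hm⟩ := exists_weight_le (d := d) hρs
  refine ⟨C, C.2, m, fun φ u => ?_⟩
  have hlow : ∀ ε : ℝ, 0 < ε → eLpNorm (fun ξ => (weight ρ ξ : ℂ) * u.hat ξ) 2 volume ≤
      ENNReal.ofReal (ε * ‖u‖ + ε⁻¹ ^ m * ‖u.toL2‖) := fun ε hε => by
    have hcont : Continuous fun ξ : Rd d => ((weight s ξ : ℝ) : ℂ) :=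
      Complex.continuous_ofReal.comp (continuous_weight s)
    have h1 : eLpNorm (fun ξ => (weight ρ ξ : ℂ) * u.hat ξ) 2 volume ≤
        eLpNorm ((fun ξ => ε * ‖(weight s ξ : ℂ) * u.hat ξ‖) + fun ξ => ε⁻¹ ^ m * ‖u.hat ξ‖)
          2 volume := by
      refine eLpNorm_mono_real fun ξ => ?_
      simp only [Pi.add_apply, norm_mul, Complex.norm_real,
        Real.norm_of_nonneg (weight_pos _ ξ).le]
      rw [← mul_assoc, ← add_mul]
      exact mul_le_mul_of_nonneg_right (hm ε hε ξ) (norm_nonneg _)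
    refine h1.trans ((eLpNorm_add_le (u.memLp_weight_hat.1.norm.const_mul _)
      (u.aestronglyMeasurable_hat.norm.const_mul _) (by norm_num)).trans_eq ?_)
    have h2 : ∀ (r : ℝ) (k : Rd d → ℂ), 0 ≤ r → eLpNorm (fun ξ => r * ‖k ξ‖) 2 volume =
        ENNReal.ofReal r * eLpNorm k 2 volume := fun r k hr => by
      have := eLpNorm_const_smul r (fun ξ => ‖k ξ‖) 2 (volume : Measure (Rd d))
      rw [eLpNorm_norm, Real.enorm_of_nonneg hr] at this
      exact this
    rw [h2 _ _ hε.le, h2 _ _ (by positivity), ← enorm_eq, ← enorm_toL2,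
      ENNReal.ofReal_add (by positivity) (by positivity), ENNReal.ofReal_mul hε.le,
      ENNReal.ofReal_mul (by positivity), ofReal_norm, ofReal_norm]
  have hest := hC φ.hat u.hat φ.aestronglyMeasurable_hat u.aestronglyMeasurable_hat
    φ.memLp_weight_hat u.memLp_weight_hat
  have hcm : AEStronglyMeasurable (conv φ.hat u.hat) :=
    aestronglyMeasurable_conv φ.aestronglyMeasurable_hat u.aestronglyMeasurable_hat
  have hcont : Continuous fun ξ : Rd d => ((weight s ξ : ℝ) : ℂ) :=
    Complex.continuous_ofReal.comp (continuous_weight s)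
  -- The estimate with `c = 0` and the crude supremum bound already shows that the product lies in
  -- `H^s`.
  obtain ⟨p, hp⟩ := exists_hat_eq hs0.le hcm ⟨hcont.aestronglyMeasurable.mul hcm, by
    have h := hest 0 (embeddingConst d s * ‖φ‖).toNNReal fun x => by
      rw [zero_add]; exact (norm_ev_le x φ).trans (Real.le_coe_toNNReal _)
    simp only [zero_mul, zero_add] at h
    refine h.trans_lt (ENNReal.add_lt_top.2 ⟨ENNReal.mul_lt_top (by simp) u.memLp_weight_hat.2,
      ENNReal.mul_lt_top (ENNReal.mul_lt_top (by simp) φ.memLp_weight_hat.2) ?_⟩)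
    exact (hlow 1 one_pos).trans_lt ENNReal.ofReal_lt_top⟩
  refine ⟨p, fun x => ?_, fun c M hM ε hε => ?_⟩
  · rw [ev_apply, ev_apply, ev_apply, Real.fourierInv_congr_ae hp,
      fourierInv_conv φ.integrable_hat u.integrable_hat]
  · have hM0 : 0 ≤ M := (norm_nonneg _).trans (hM 0)
    lift M to ℝ≥0 using hM0
    have h := hest c M hM
    have e : ‖c • u + p‖ₑ = eLpNorm (fun ξ => (weight s ξ : ℂ) *
        (c * u.hat ξ + conv φ.hat u.hat ξ)) 2 volume := by
      rw [enorm_eq]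
      refine eLpNorm_congr_ae ?_
      filter_upwards [hp, hat_add (c • u) p, hat_smul c u] with ξ h1 h2 h3
      rw [h2, Pi.add_apply, h3, h1, Pi.smul_apply, smul_eq_mul]
    rw [← e, ← enorm_eq, ← enorm_eq] at h
    have h5 : ‖c • u + p‖ₑ ≤ ENNReal.ofReal
        (M * ‖u‖ + C * ‖φ‖ * (ε * ‖u‖ + ε⁻¹ ^ m * ‖u.toL2‖)) := by
      refine h.trans ?_
      rw [ENNReal.ofReal_add (by positivity) (by positivity), ENNReal.ofReal_mul M.coe_nonneg,
        ENNReal.ofReal_mul (by positivity), ENNReal.ofReal_mul C.coe_nonneg, ofReal_norm, ofReal_norm,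
        ENNReal.ofReal_coe_nnreal, ENNReal.ofReal_coe_nnreal]
      gcongr
      exact hlow ε hε
    rw [← ofReal_norm] at h5
    exact (ENNReal.ofReal_le_ofReal_iff (by positivity)).1 h5

end Mul

/-! ### The exponential on `H^s` -/

section Exp
variable {d : ℕ} {s : ℝ} [hs : Fact ((d : ℝ) / 2 < s)]

variable (d s) in
theorem exists_mulCLM : ∃ m : Hs d s →L[ℂ] Hs d s →L[ℂ] Hs d s,
    ∀ φ u x, ev x (m φ u) = ev x φ * ev x u := by
  obtain ⟨C, hC, m, h⟩ := exists_mul d s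
  choose p hp hest using h
  refine ⟨LinearMap.mkContinuous₂ (LinearMap.mk₂ ℂ p ?_ ?_ ?_ ?_) (embeddingConst d s + 2 * C) ?_,
    fun φ u x => hp φ u x⟩
  · intro φ ψ u
    refine ext_ev fun x => ?_
    simp only [hp, map_add]
    ring
  · intro c φ u
    refine ext_ev fun x => ?_
    simp only [hp, map_smul, smul_eq_mul]
    ring
  · intro φ u v
    refine ext_ev fun x => ?_
    simp only [hp, map_add]
    ring
  · intro c φ u
    refine ext_ev fun x => ?_
    simp only [hp, map_smul, smul_eq_mul]
    ring
  · intro φ u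
    have h1 := hest φ u 0 (embeddingConst d s * ‖φ‖)
      (fun x => by rw [zero_add]; exact norm_ev_le x φ) 1 one_pos
    have h2 := norm_toL2_le (order_pos hs.out).le u
    simp only [zero_smul, zero_add, inv_one, one_pow, one_mul] at h1
    have h3 : C * ‖φ‖ * (‖u‖ + ‖u.toL2‖) ≤ C * ‖φ‖ * (‖u‖ + ‖u‖) := by gcongr
    simp only [LinearMap.mk₂_apply]
    linarith

/-- The pointwise product on `H^s`. -/
def mul : Hs d s →L[ℂ] Hs d s →L[ℂ] Hs d s := (exists_mulCLM d s).choose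

@[simp] theorem ev_mul (φ u : Hs d s) (x : Rd d) : ev x (mul φ u) = ev x φ * ev x u :=
  (exists_mulCLM d s).choose_spec φ u x

theorem exists_expm1 (φ : Hs d s) : ∃ e : Hs d s, (∀ x, ev x e = Complex.exp (ev x φ) - 1) ∧
    ‖e‖ ≤ ‖φ‖ * Real.exp (‖(mul : Hs d s →L[ℂ] Hs d s →L[ℂ] Hs d s)‖ * ‖φ‖) := by
  set K := ‖(mul : Hs d s →L[ℂ] Hs d s →L[ℂ] Hs d s)‖ with hK
  -- The exponential series without its constant term, which need not lie in `H^s`.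
  set t : ℕ → Hs d s := fun n => ((n + 1).factorial : ℂ)⁻¹ • ((mul φ) ^ n) φ with ht
  have hpow : ∀ n, ‖((mul φ) ^ n) φ‖ ≤ (K * ‖φ‖) ^ n * ‖φ‖ := fun n => by
    induction n with
    | zero => simp
    | succ n ih =>
      rw [pow_succ', mul_apply_eq_comp]
      refine (mul.le_opNorm₂ φ _).trans ?_
      calc K * ‖φ‖ * ‖(mul φ ^ n) φ‖ ≤ K * ‖φ‖ * ((K * ‖φ‖) ^ n * ‖φ‖) := by gcongr
        _ = _ := by ring
  have hbound : ∀ n, ‖t n‖ ≤ (K * ‖φ‖) ^ n / n.factorial * ‖φ‖ := fun n => by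
    rw [ht, norm_smul, norm_inv, Complex.norm_natCast, div_mul_eq_mul_div, inv_mul_eq_div]
    have : (0 : ℝ) < n.factorial := by positivity
    have h1 : (n.factorial : ℝ) ≤ (n + 1).factorial := by
      exact_mod_cast Nat.factorial_le (Nat.le_succ n)
    exact div_le_div₀ (by positivity) (hpow n) this h1
  have hsum : HasSum (fun n : ℕ => (K * ‖φ‖) ^ n / n.factorial * ‖φ‖)
      (Real.exp (K * ‖φ‖) * ‖φ‖) := by
    rw [Real.exp_eq_exp_ℝ]
    exact (NormedSpace.expSeries_div_hasSum_exp (K * ‖φ‖)).mul_right _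
  have hst : Summable t := Summable.of_norm_bounded hsum.summable hbound
  refine ⟨∑' n, t n, fun x => ?_, ?_⟩
  · have hev : ∀ n, ev x (t n) = ev x φ ^ (n + 1) / (n + 1).factorial := fun n => by
      have : ∀ n, ev x (((mul φ) ^ n) φ) = ev x φ ^ (n + 1) := fun n => by
        induction n with
        | zero => simp
        | succ n ih =>
          rw [pow_succ', mul_apply_eq_comp, ev_mul, ih]
          ring
      rw [ht, map_smul, this, smul_eq_mul]
      ring
    have h1 : HasSum (fun n : ℕ => ev x φ ^ n / n.factorial) (Complex.exp (ev x φ)) := by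
      rw [Complex.exp_eq_exp_ℂ]
      exact NormedSpace.expSeries_div_hasSum_exp _
    have h2 := (hasSum_nat_add_iff' 1).2 h1
    have h3 := hst.hasSum.mapL (ev x)
    simp only [hev] at h3
    simpa using h3.unique h2
  · rw [mul_comm]
    exact tsum_of_norm_bounded hsum hbound

/-- The element `e^φ - 1` of `H^s`. -/
def expm1 (φ : Hs d s) : Hs d s := (exists_expm1 φ).choose

@[simp] theorem ev_expm1 (φ : Hs d s) (x : Rd d) : ev x (expm1 φ) = Complex.exp (ev x φ) - 1 :=
  (exists_expm1 φ).choose_spec.1 x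

theorem norm_expm1_le (φ : Hs d s) :
    ‖expm1 φ‖ ≤ ‖φ‖ * Real.exp (‖(mul : Hs d s →L[ℂ] Hs d s →L[ℂ] Hs d s)‖ * ‖φ‖) :=
  (exists_expm1 φ).choose_spec.2

/-- The first two terms are `e^φ (e^ψ - 1)`, in the form `c • u + p` of `exists_mul` with `c = 1`.
-/
theorem expm1_add (φ ψ : Hs d s) :
    expm1 (φ + ψ) = expm1 ψ + mul (expm1 φ) (expm1 ψ) + expm1 φ := by
  refine ext_ev fun x => ?_
  simp only [ev_expm1, map_add, ev_mul, Complex.exp_add]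
  ring

@[simp] theorem expm1_zero : expm1 (0 : Hs d s) = 0 := by
  refine ext_ev fun x => ?_
  simp

theorem norm_exp_of_re_eq_zero {z : ℂ} (hz : z.re = 0) : ‖Complex.exp z‖ = 1 := by
  rw [Complex.norm_exp, hz, Real.exp_zero]

theorem norm_toL2_expm1_le {φ : Hs d s} (hφ : ∀ x, (ev x φ).re = 0) :
    ‖(expm1 φ).toL2‖ ≤ ‖φ.toL2‖ := by
  refine Lp.norm_le_norm_of_ae_le ?_
  filter_upwards [toL2_ae_eq φ, toL2_ae_eq (expm1 φ)] with x h1 h2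
  rw [h1, h2, ev_expm1]
  have e : ev x φ = Complex.I * ((ev x φ).im : ℂ) := by
    apply Complex.ext <;> simp [hφ x]
  rw [e]
  refine (Real.norm_exp_I_mul_ofReal_sub_one_le).trans ?_
  simp

variable (d s) in
/-- For purely imaginary `φ` the norm of `e^φ - 1` grows at most polynomially. -/
theorem exists_norm_expm1_le : ∃ K : ℝ, 0 ≤ K ∧ ∃ N : ℕ, ∀ φ : Hs d s,
    (∀ x, (ev x φ).re = 0) → ‖expm1 φ‖ ≤ K * ‖φ‖ * (1 + ‖φ‖) ^ N := by
  obtain ⟨C, hC, m, h⟩ := exists_mul d s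
  set L := Real.exp ‖(mul : Hs d s →L[ℂ] Hs d s →L[ℂ] Hs d s)‖ with hL
  have hL0 : 0 < L := Real.exp_pos _
  set D := 2 * (C * L + 1) with hD
  have hD0 : 0 < D := by positivity
  refine ⟨2 * (C * L * D ^ m + L), by positivity, m + 1, fun φ hφ => ?_⟩
  -- With `n ≥ ‖φ‖` pieces, each `ψ` has norm at most one, so the exponential factor in
  -- `norm_expm1_le` is at most `L`. The `+ 1` keeps `n` positive when `φ = 0`.
  set n : ℕ := ⌈‖φ‖⌉₊ + 1 with hn
  have hn0 : (0 : ℝ) < n := by positivity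
  have hnφ : ‖φ‖ ≤ n := by
    rw [hn]; push_cast; linarith [Nat.le_ceil ‖φ‖]
  set ψ : Hs d s := ((n : ℝ)⁻¹ : ℂ) • φ with hψ
  have hnψ : ‖ψ‖ = ‖φ‖ / n := by
    rw [hψ, norm_smul, norm_inv, Complex.norm_real, Real.norm_of_nonneg hn0.le]
    ring
  have hψ1 : ‖ψ‖ ≤ 1 := by rw [hnψ]; exact (div_le_one hn0).2 hnφ
  have hre : ∀ (k : ℕ) x, (ev x ((k : ℂ) • ψ)).re = 0 := fun k x => by
    simp only [hψ, map_smul, smul_eq_mul]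
    rw [← mul_assoc, ← Complex.ofReal_natCast k, ← Complex.ofReal_inv, ← Complex.ofReal_mul,
      Complex.re_ofReal_mul, hφ, mul_zero]
  have hV : ‖expm1 ψ‖ ≤ L * (‖φ‖ / n) := by
    refine (norm_expm1_le ψ).trans ?_
    rw [mul_comm, ← hnψ]
    gcongr
    exact Real.exp_le_exp.2 (mul_le_of_le_one_right (ContinuousLinearMap.opNorm_nonneg _) hψ1)
  -- Chosen so that `C * L * ‖φ‖ * ε ≤ 1 / 2`: the `ε * Y` term is absorbed into half of `Y`, and
  -- `Y` is twice what remains. As `ε⁻¹` is linear in `‖φ‖`, `Y` stays polynomial.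
  set ε : ℝ := (D * (1 + ‖φ‖))⁻¹ with hε
  have hε0 : 0 < ε := by positivity
  set Y : ℝ := 2 * (C * L * ‖φ‖ * (ε⁻¹ ^ m * ‖φ‖) + L * ‖φ‖) with hY
  have hY0 : 0 ≤ Y := by positivity
  have hYstep : C * L * ‖φ‖ * (ε * Y + ε⁻¹ ^ m * ‖φ‖) + L * ‖φ‖ ≤ Y := by
    have h1 : C * L * ‖φ‖ * ε ≤ 1 / 2 := by
      rw [hε, ← div_eq_mul_inv, div_le_iff₀ (by positivity), hD]
      have : 0 ≤ C * L := by positivity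
      nlinarith [norm_nonneg φ]
    have h2 := mul_le_mul_of_nonneg_right h1 hY0
    nlinarith
  have hind : ∀ k : ℕ, k ≤ n → ‖expm1 ((k : ℂ) • ψ)‖ ≤ k / n * Y := fun k => by
    induction k with
    | zero => intro _; simp
    | succ k ih =>
      intro hk
      have ih' := ih (Nat.le_of_succ_le hk)
      have hkn : (k : ℝ) ≤ n := by exact_mod_cast Nat.le_of_succ_le hk
      set U := expm1 ((k : ℂ) • ψ) with hU
      have e : expm1 (((k + 1 : ℕ) : ℂ) • ψ) = ((1 : ℂ) • U + mul (expm1 ψ) U) + expm1 ψ := by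
        rw [one_smul, hU, ← expm1_add]
        congr 1
        push_cast
        rw [add_smul, one_smul, add_comm]
      obtain ⟨p, hp, hest⟩ := h (expm1 ψ) U
      have hpm : p = mul (expm1 ψ) U := ext_ev fun x => by rw [hp, ev_mul]
      -- Here `|e^ψ| = 1`, so the coefficient of `‖U‖` is one and the step adds at most `Y / n`.
      have h1 := hest 1 1 (fun x => by
        rw [ev_expm1, add_sub_cancel]
        refine (norm_exp_of_re_eq_zero ?_).le
        simpa using hre 1 x) ε hε0
      rw [hpm, one_mul] at h1
      have hU0 : ‖U.toL2‖ ≤ ‖φ‖ := by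
        refine (norm_toL2_expm1_le (hre k)).trans ((norm_toL2_le (order_pos hs.out).le _).trans ?_)
        rw [norm_smul, hnψ, Complex.norm_natCast, mul_div_left_comm]
        exact mul_le_of_le_one_right (norm_nonneg _) ((div_le_one hn0).2 hkn)
      have hUY : ‖U‖ ≤ Y := ih'.trans (mul_le_of_le_one_left hY0 ((div_le_one hn0).2 hkn))
      rw [e]
      calc ‖((1 : ℂ) • U + mul (expm1 ψ) U) + expm1 ψ‖
          ≤ ‖(1 : ℂ) • U + mul (expm1 ψ) U‖ + ‖expm1 ψ‖ := norm_add_le _ _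
        _ ≤ (‖U‖ + C * ‖expm1 ψ‖ * (ε * ‖U‖ + ε⁻¹ ^ m * ‖U.toL2‖)) + ‖expm1 ψ‖ := by gcongr
        _ ≤ (k / n * Y + C * (L * (‖φ‖ / n)) * (ε * Y + ε⁻¹ ^ m * ‖φ‖)) + L * (‖φ‖ / n) := by
            gcongr
        _ = k / n * Y + (C * L * ‖φ‖ * (ε * Y + ε⁻¹ ^ m * ‖φ‖) + L * ‖φ‖) / n := by ring
        _ ≤ k / n * Y + Y / n := by gcongr
        _ = _ := by push_cast; ring
  have hfin := hind n le_rfl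
  have e1 : (n : ℂ) • ψ = φ := by
    rw [hψ, smul_smul, Complex.ofReal_natCast, mul_inv_cancel₀ (by exact_mod_cast hn0.ne'), one_smul]
  rw [e1, div_self hn0.ne', one_mul] at hfin
  refine hfin.trans ?_
  have h1 : (1 : ℝ) ≤ (1 + ‖φ‖) ^ (m + 1) := one_le_pow₀ (by linarith [norm_nonneg φ])
  have h2 : ε⁻¹ ^ m * ‖φ‖ ≤ D ^ m * (1 + ‖φ‖) ^ (m + 1) := by
    rw [hε, inv_inv, mul_pow, pow_succ, ← mul_assoc]
    gcongr
    linarith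
  calc Y ≤ 2 * (C * L * ‖φ‖ * (D ^ m * (1 + ‖φ‖) ^ (m + 1)) + L * ‖φ‖ * (1 + ‖φ‖) ^ (m + 1)) := by
        rw [hY]
        refine mul_le_mul_of_nonneg_left (add_le_add ?_ ?_) two_pos.le
        · gcongr
        · exact le_mul_of_one_le_right (by positivity) h1
    _ = _ := by ring

end Exp

/-! ### Composition with Schwartz functions -/

section Composition
variable {d : ℕ} {s : ℝ} [hs : Fact ((d : ℝ) / 2 < s)]

/-- The complex conjugate of `u`. -/
def conj (u : Hs d s) : Hs d s := (exists_conj u).choose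

theorem norm_conj (u : Hs d s) : ‖conj u‖ = ‖u‖ := (exists_conj u).choose_spec.1

@[simp] theorem ev_conj (u : Hs d s) (x : Rd d) : ev x (conj u) = starRingEnd ℂ (ev x u) :=
  (exists_conj u).choose_spec.2 x

/-- The function `2πi⟨u, ζ⟩`, where `⟨·, ·⟩` is the real inner product of `ℂ`. -/
def phase (ζ : ℂ) (u : Hs d s) : Hs d s :=
  (Real.pi * Complex.I * starRingEnd ℂ ζ) • u + (Real.pi * Complex.I * ζ) • conj u

theorem ev_phase (ζ : ℂ) (u : Hs d s) (x : Rd d) :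
    ev x (phase ζ u) = ((2 * Real.pi * inner ℝ (ev x u) ζ : ℝ) : ℂ) * Complex.I := by
  simp only [phase, map_add, map_smul, smul_eq_mul, ev_conj, Complex.inner]
  apply Complex.ext
  · simp
  · simp
    ring

theorem norm_phase_le (ζ : ℂ) (u : Hs d s) : ‖phase ζ u‖ ≤ 2 * Real.pi * ‖ζ‖ * ‖u‖ := by
  refine (norm_add_le _ _).trans_eq ?_
  rw [norm_smul, norm_smul, norm_conj]
  simp only [norm_mul, Complex.norm_real, Real.norm_of_nonneg Real.pi_pos.le, Complex.norm_I,
    RCLike.norm_conj]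
  ring

theorem phase_add_left (ζ η : ℂ) (u : Hs d s) : phase (ζ + η) u = phase ζ u + phase η u := by
  refine ext_ev fun x => ?_
  simp only [map_add, ev_phase, inner_add_right]
  push_cast
  ring

theorem phase_add_right (ζ : ℂ) (u v : Hs d s) : phase ζ (u + v) = phase ζ u + phase ζ v := by
  refine ext_ev fun x => ?_
  simp only [map_add, ev_phase, inner_add_left]
  push_cast
  ring

variable (d s) in
theorem exists_norm_expm1_phase_le (R : ℝ) (hR : 0 ≤ R) : ∃ A : ℝ, 0 ≤ A ∧ ∃ N : ℕ,
    ∀ (ζ : ℂ) (u : Hs d s), ‖u‖ ≤ R → ‖expm1 (phase ζ u)‖ ≤ A * ‖u‖ * (‖ζ‖ * (1 + ‖ζ‖) ^ N) := by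
  obtain ⟨K, hK, N, h⟩ := exists_norm_expm1_le d s
  have hpi := Real.pi_pos
  refine ⟨K * (2 * Real.pi) * (1 + 2 * Real.pi * R) ^ N, by positivity, N, fun ζ u hu => ?_⟩
  have h1 := h (phase ζ u) fun x => by rw [ev_phase]; simp
  have h2 := norm_phase_le ζ u
  have h3 : 1 + ‖phase ζ u‖ ≤ (1 + 2 * Real.pi * R) * (1 + ‖ζ‖) := by
    have : 2 * Real.pi * ‖ζ‖ * ‖u‖ ≤ 2 * Real.pi * ‖ζ‖ * R := by gcongr
    have : 0 ≤ 2 * Real.pi * R := by positivity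
    nlinarith [norm_nonneg ζ]
  calc _ ≤ _ := h1
    _ ≤ K * (2 * Real.pi * ‖ζ‖ * ‖u‖) * ((1 + 2 * Real.pi * R) * (1 + ‖ζ‖)) ^ N := by gcongr
    _ = _ := by rw [mul_pow]; ring

/-- Gives measurability of the Bochner integrand. The increment from `ζ` to `η` is `e^{2πi⟨u,ζ⟩}`
times `e^{2πi⟨u,η-ζ⟩} - 1`, which is small by the polynomial bound. -/
theorem continuous_expm1_phase (u : Hs d s) : Continuous fun ζ : ℂ => expm1 (phase ζ u) := by
  obtain ⟨A, hA, N, h⟩ := exists_norm_expm1_phase_le d s ‖u‖ (norm_nonneg u)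
  rw [continuous_iff_continuousAt]
  intro ζ
  rw [ContinuousAt, tendsto_iff_norm_sub_tendsto_zero]
  refine squeeze_zero (g := fun η => A * ‖u‖ * (‖η - ζ‖ * (1 + ‖η - ζ‖) ^ N) *
    (1 + ‖mul (expm1 (phase ζ u))‖)) (fun _ => norm_nonneg _) (fun η => ?_) ?_
  · have e : expm1 (phase η u) - expm1 (phase ζ u) =
        expm1 (phase (η - ζ) u) + mul (expm1 (phase ζ u)) (expm1 (phase (η - ζ) u)) := by
      have : phase η u = phase ζ u + phase (η - ζ) u := by
        rw [← phase_add_left, add_sub_cancel]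
      rw [this, expm1_add]
      abel
    rw [e]
    have h1 := h (η - ζ) u le_rfl
    refine (norm_add_le _ _).trans ?_
    have h2 := (mul (expm1 (phase ζ u))).le_opNorm (expm1 (phase (η - ζ) u))
    have h3 := mul_le_mul_of_nonneg_right h1 (norm_nonneg (mul (expm1 (phase ζ u))))
    linarith
  · have hc : Continuous fun η : ℂ => A * ‖u‖ * (‖η - ζ‖ * (1 + ‖η - ζ‖) ^ N) *
        (1 + ‖mul (expm1 (phase ζ u))‖) := by fun_prop
    simpa using hc.tendsto ζ

theorem _root_.SchwartzMap.integrable_one_add_norm_pow_mul (G : 𝓢(ℂ, ℂ)) (N : ℕ) :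
    Integrable fun ζ => (1 + ‖ζ‖) ^ N * ‖G ζ‖ := by
  refine (((G.integrable_pow_mul volume 0).add (G.integrable_pow_mul volume N)).const_mul
    ((2 : ℝ) ^ (N - 1))).mono' ?_ (Filter.Eventually.of_forall fun ζ => ?_)
  · exact Continuous.aestronglyMeasurable (by fun_prop)
  · rw [Real.norm_of_nonneg (by positivity)]
    have := add_pow_le zero_le_one (norm_nonneg ζ) N
    simp only [Pi.add_apply, pow_zero, one_mul, one_pow] at this ⊢
    calc _ ≤ (2 ^ (N - 1) * (1 + ‖ζ‖ ^ N)) * ‖G ζ‖ := by gcongr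
      _ = _ := by ring

theorem integrable_smul_expm1_phase (G : 𝓢(ℂ, ℂ)) (u : Hs d s) :
    Integrable fun ζ => G ζ • expm1 (phase ζ u) := by
  obtain ⟨A, hA, N, h⟩ := exists_norm_expm1_phase_le d s ‖u‖ (norm_nonneg u)
  refine ((G.integrable_one_add_norm_pow_mul (N + 1)).const_mul (A * ‖u‖)).mono'
    (G.continuous.smul (continuous_expm1_phase u)).aestronglyMeasurable
    (Filter.Eventually.of_forall fun ζ => ?_)
  rw [norm_smul]
  calc _ ≤ ‖G ζ‖ * (A * ‖u‖ * (‖ζ‖ * (1 + ‖ζ‖) ^ N)) := by gcongr; exact h ζ u le_rfl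
    _ ≤ ‖G ζ‖ * (A * ‖u‖ * ((1 + ‖ζ‖) * (1 + ‖ζ‖) ^ N)) := by gcongr; linarith
    _ = _ := by ring

/-- Composition with a Schwartz function `g`, written as a superposition of the functions
`e^{2πi⟨u, ζ⟩} - 1`. -/
def schwartzComp (g : 𝓢(ℂ, ℂ)) (u : Hs d s) : Hs d s := ∫ ζ, 𝓕 g ζ • expm1 (phase ζ u)

/-- Evaluation is continuous, so it passes under the integral; Fourier inversion at `ev x u` and at
`0` does the rest. -/
theorem ev_schwartzComp (g : 𝓢(ℂ, ℂ)) (u : Hs d s) (x : Rd d) :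
    ev x (schwartzComp g u) = g (ev x u) - g 0 := by
  have hinv : ∀ z : ℂ, g z = ∫ ζ, Real.fourierChar (inner ℝ ζ z) • 𝓕 g ζ := fun z => by
    rw [← Real.fourierInv_eq, ← SchwartzMap.fourierInv_coe, FourierTransform.fourierInv_fourier_eq]
  have hint : ∀ z : ℂ, Integrable fun ζ : ℂ => Real.fourierChar (inner ℝ ζ z) • 𝓕 g ζ := fun z => by
    simpa using (Real.fourierIntegral_convergent_iff (-z)).2 (𝓕 g).integrable
  rw [schwartzComp, ← ContinuousLinearMap.integral_comp_comm _ (integrable_smul_expm1_phase _ u),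
    hinv (ev x u), hinv 0, ← integral_sub (hint _) (hint _)]
  refine integral_congr_ae (Filter.Eventually.of_forall fun ζ => ?_)
  simp only [map_smul, smul_eq_mul, ev_expm1, ev_phase, Circle.smul_def, Real.fourierChar_apply,
    inner_zero_right, mul_zero, Complex.ofReal_zero, zero_mul, Complex.exp_zero,
    real_inner_comm ζ (ev x u)]
  ring

theorem exists_norm_schwartzComp_sub_le (g : 𝓢(ℂ, ℂ)) (R : ℝ) (hR : 0 ≤ R) :
    ∃ K : ℝ≥0, ∀ u v : Hs d s, ‖u‖ ≤ R → ‖v‖ ≤ R →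
      ‖schwartzComp g u - schwartzComp g v‖ ≤ K * ‖u - v‖ := by
  -- The bound is applied to `v` and to the difference `u - v`, which lies in the ball of radius `2
  -- * R`.
  obtain ⟨A, hA, N, h⟩ := exists_norm_expm1_phase_le d s (2 * R) (by linarith)
  set m := ‖(mul : Hs d s →L[ℂ] Hs d s →L[ℂ] Hs d s)‖ with hm
  have hm0 : 0 ≤ m := ContinuousLinearMap.opNorm_nonneg _
  set Q : ℝ := A * (1 + m * (A * (2 * R))) with hQ
  have hQ0 : 0 ≤ Q := by positivity
  set J := ∫ ζ, (1 + ‖ζ‖) ^ (2 * (N + 1)) * ‖𝓕 g ζ‖ with hJ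
  have hJ0 : 0 ≤ J := integral_nonneg fun ζ => by positivity
  refine ⟨⟨Q * J, by positivity⟩, fun u v hu hv => ?_⟩
  have huv : ‖u - v‖ ≤ 2 * R := (norm_sub_le u v).trans (by linarith)
  rw [schwartzComp, schwartzComp, ← integral_sub (integrable_smul_expm1_phase _ u)
    (integrable_smul_expm1_phase _ v)]
  have hb : ∀ ζ, ‖𝓕 g ζ • expm1 (phase ζ u) - 𝓕 g ζ • expm1 (phase ζ v)‖ ≤
      Q * ‖u - v‖ * ((1 + ‖ζ‖) ^ (2 * (N + 1)) * ‖𝓕 g ζ‖) := fun ζ => by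
    set P := (1 + ‖ζ‖) ^ (N + 1) with hP
    have hP1 : 1 ≤ P := one_le_pow₀ (by linarith [norm_nonneg ζ])
    have hzP : ‖ζ‖ * (1 + ‖ζ‖) ^ N ≤ P := by
      rw [hP, pow_succ']
      gcongr
      linarith
    have e : expm1 (phase ζ u) - expm1 (phase ζ v) =
        expm1 (phase ζ (u - v)) + mul (expm1 (phase ζ v)) (expm1 (phase ζ (u - v))) := by
      have : phase ζ u = phase ζ v + phase ζ (u - v) := by
        rw [← phase_add_right, add_sub_cancel]
      rw [this, expm1_add]
      abel
    have h1 : ‖expm1 (phase ζ (u - v))‖ ≤ A * ‖u - v‖ * P :=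
      (h ζ (u - v) huv).trans (by gcongr)
    have h2 : ‖expm1 (phase ζ v)‖ ≤ A * (2 * R) * P :=
      (h ζ v (by linarith)).trans (by gcongr; linarith)
    rw [← smul_sub, norm_smul, e]
    calc _ ≤ ‖𝓕 g ζ‖ * (‖expm1 (phase ζ (u - v))‖ +
          m * ‖expm1 (phase ζ v)‖ * ‖expm1 (phase ζ (u - v))‖) := by
          gcongr
          exact (norm_add_le _ _).trans (add_le_add le_rfl (mul.le_opNorm₂ _ _))
      _ ≤ ‖𝓕 g ζ‖ * (A * ‖u - v‖ * P * P + m * (A * (2 * R) * P) * (A * ‖u - v‖ * P)) := by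
          gcongr
          exact h1.trans (le_mul_of_one_le_right (by positivity) hP1)
      _ = _ := by
          rw [mul_comm 2 (N + 1), pow_mul, ← hP, hQ]
          ring
  refine (norm_integral_le_of_norm_le
    (((𝓕 g).integrable_one_add_norm_pow_mul _).const_mul _)
    (Filter.Eventually.of_forall hb)).trans_eq ?_
  rw [integral_const_mul, ← hJ]
  change _ = Q * J * ‖u - v‖
  ring

end Composition

end Hs

/-! ### Cutoff, Taylor remainder and multiplication operators on `L²` -/

theorem exists_schwartzMap_eq {f : ℂ → ℂ} (hf : ContDiff ℝ ∞ f) (M : ℝ) :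
    ∃ g : 𝓢(ℂ, ℂ), ∀ z, ‖z‖ ≤ M → g z = f z := by
  let χ : ContDiffBump (0 : ℂ) := ⟨|M| + 1, |M| + 2, by positivity, by linarith⟩
  have hc : HasCompactSupport fun z => χ z • f z := χ.hasCompactSupport.smul_right
  have hs : ContDiff ℝ ∞ fun z => χ z • f z := χ.contDiff.smul hf
  refine ⟨hc.toSchwartzMap hs, fun z hz => ?_⟩
  change χ z • f z = f z
  rw [χ.one_of_mem_closedBall, one_smul]
  rw [mem_closedBall_zero_iff]
  exact hz.trans ((le_abs_self M).trans (le_add_of_nonneg_right zero_le_one))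

theorem exists_norm_fderiv_le {f : ℂ → ℂ} (hf : ContDiff ℝ ∞ f) (M : ℝ) :
    ∃ C : ℝ, 0 < C ∧ ∀ z, ‖z‖ ≤ M → ‖fderiv ℝ f z‖ ≤ C := by
  obtain ⟨C, hC⟩ := (isCompact_closedBall (0 : ℂ) M).exists_bound_of_continuousOn
    (hf.continuous_fderiv (by simp)).continuousOn
  exact ⟨max C 1, by positivity, fun z hz =>
    (hC z (mem_closedBall_zero_iff.2 hz)).trans (le_max_left _ _)⟩

/-- The mean value inequality reduces this to the oscillation of the derivative near `a`, uniformly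
small on the disc of radius `M + 1`. -/
theorem exists_norm_sub_sub_fderiv_le {f : ℂ → ℂ} (hf : ContDiff ℝ ∞ f) (M : ℝ) {ε : ℝ}
    (hε : 0 < ε) : ∃ δ : ℝ, 0 < δ ∧ ∀ a b : ℂ, ‖a‖ ≤ M → ‖b‖ < δ →
      ‖f (a + b) - f a - fderiv ℝ f a b‖ ≤ ε * ‖b‖ := by
  have huc := (isCompact_closedBall (0 : ℂ) (M + 1)).uniformContinuousOn_of_continuous
    (hf.continuous_fderiv (by simp)).continuousOn
  obtain ⟨δ, hδ, h⟩ := Metric.uniformContinuousOn_iff.1 huc ε hε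
  refine ⟨min δ 1, by positivity, fun a b ha hb => ?_⟩
  have hd : ∀ z ∈ Metric.ball a (min δ 1), HasFDerivWithinAt f (fderiv ℝ f z)
      (Metric.ball a (min δ 1)) z := fun z _ =>
    (hf.differentiable (by simp) z).hasFDerivAt.hasFDerivWithinAt
  have h1 := (convex_ball a (min δ 1)).norm_image_sub_le_of_norm_hasFDerivWithin_le'
    (φ := fderiv ℝ f a) (C := ε) hd (fun z hz => ?_)
    (Metric.mem_ball_self (by positivity)) (y := a + b)
    (by simpa [Metric.mem_ball, dist_eq_norm] using hb)
  · simpa using h1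
  · have hz' := Metric.mem_ball.1 hz
    rw [← dist_eq_norm]
    refine (h z ?_ a ?_ (hz'.trans_le (min_le_left _ _))).le
    · rw [mem_closedBall_zero_iff]
      have := norm_le_norm_add_norm_sub' z a
      rw [← dist_eq_norm] at this
      linarith [hz'.trans_le (min_le_right _ _)]
    · rw [mem_closedBall_zero_iff]
      linarith

/-- Multiplication by a bounded operator-valued function is bounded on `L²`. -/
theorem exists_mulOperator {d : ℕ} {ψ : Rd d → ℂ →L[ℝ] ℂ} (hψ : AEStronglyMeasurable ψ) {C : ℝ}
    (hC : 0 ≤ C) (hψC : ∀ᵐ x, ‖ψ x‖ ≤ C) :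
    ∃ T : L2 d →L[ℝ] L2 d, ‖T‖ ≤ C ∧ ∀ v : L2 d, T v =ᵐ[volume] fun x => ψ x (v x) := by
  have hle : ∀ v : L2 d, ∀ᵐ x, ‖ψ x (v x)‖ ≤ C * ‖v x‖ := fun v => by
    filter_upwards [hψC] with x hx
    exact (ψ x).le_of_opNorm_le hx _
  have hmem : ∀ v : L2 d, MemLp (fun x => ψ x (v x)) 2 := fun v =>
    (Lp.memLp v).of_le_mul
      (isBoundedBilinearMap_apply.continuous.comp_aestronglyMeasurable
        (hψ.prodMk (Lp.aestronglyMeasurable v))) (hle v)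
  refine ⟨LinearMap.mkContinuous
    { toFun := fun v => (hmem v).toLp
      map_add' := fun u v => ?_
      map_smul' := fun c v => ?_ } C fun v => ?_, LinearMap.mkContinuous_norm_le _ hC _,
    fun v => (hmem v).coeFn_toLp⟩
  · rw [← MemLp.toLp_add]
    refine MemLp.toLp_congr _ _ ?_
    filter_upwards [Lp.coeFn_add u v] with x hx
    rw [hx, Pi.add_apply, Pi.add_apply, map_add]
  · rw [RingHom.id_apply, ← MemLp.toLp_const_smul]
    refine MemLp.toLp_congr _ _ ?_
    filter_upwards [Lp.coeFn_smul c v] with x hx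
    rw [hx, Pi.smul_apply, Pi.smul_apply, map_smul]
  · refine Lp.norm_le_mul_norm_of_ae_le_mul ?_
    filter_upwards [hle v, (hmem v).coeFn_toLp] with x h1 h2
    simpa [h2] using h1

end LocalNonlinearity

end

/-! ### The theorem -/

theorem mainTheorem7 (d : ℕ) (s : ℝ) (hs : (d : ℝ) / 2 < s)
    (f : ℂ → ℂ) (hf : ContDiff ℝ ∞ f) (hf0 : f 0 = 0) :
    ∃ (B : LocalNonlinearity.Hs d s → LocalNonlinearity.Hs d s)
      (B' : LocalNonlinearity.Hs d s →
        (LocalNonlinearity.L2 d →L[ℝ] LocalNonlinearity.L2 d)),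
      (∀ u, ⇑(B u).toL2 =ᵐ[volume] fun x => f (u.toL2 x)) ∧
      (∀ R : ℝ, 0 < R → ∃ K : ℝ≥0, LipschitzOnWith K B (Metric.closedBall 0 R)) ∧
      (∀ u v, ⇑(B' u v) =ᵐ[volume] fun x => fderiv ℝ f (u.toL2 x) (v x)) ∧
      (∀ R ε : ℝ, 0 < R → 0 < ε → ∃ C δ : ℝ, 0 < C ∧ 0 < δ ∧
        ∀ u w : LocalNonlinearity.Hs d s, ‖u‖ ≤ R → ‖w‖ < δ →
          ‖B' u‖ ≤ C ∧
          ‖(B (u + w)).toL2 - (B u).toL2 - B' u w.toL2‖ ≤ ε * ‖w.toL2‖) := by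
  open LocalNonlinearity LocalNonlinearity.Hs in
  have : Fact ((d : ℝ) / 2 < s) := ⟨hs⟩
  set E := embeddingConst d s with hE
  have hE0 : 0 ≤ E := embeddingConst_nonneg
  have hcomp : ∀ R : ℝ, ∃ g : 𝓢(ℂ, ℂ), ∀ u : Hs d s, ‖u‖ ≤ R → ∀ x,
      ev x (schwartzComp g u) = f (ev x u) := fun R => by
    obtain ⟨g, hg⟩ := exists_schwartzMap_eq hf (E * R)
    refine ⟨g, fun u hu x => ?_⟩
    have hR : 0 ≤ R := (norm_nonneg u).trans hu
    rw [ev_schwartzComp, hg _ ((norm_ev_le x u).trans (by gcongr)),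
      hg 0 (by rw [norm_zero]; positivity), hf0, sub_zero]
  have hB : ∀ u : Hs d s, ∃ v : Hs d s, ∀ x, ev x v = f (ev x u) := fun u => by
    obtain ⟨g, hg⟩ := hcomp ‖u‖
    exact ⟨_, hg u le_rfl⟩
  choose B hBev using hB
  have hbound : ∀ R : ℝ, ∃ C : ℝ, 0 < C ∧ ∀ u : Hs d s, ‖u‖ ≤ R →
      ∀ᵐ x, ‖fderiv ℝ f (u.toL2 x)‖ ≤ C := fun R => by
    obtain ⟨C, hC, h⟩ := exists_norm_fderiv_le hf (E * R)
    refine ⟨C, hC, fun u hu => ?_⟩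
    filter_upwards [toL2_ae_eq u] with x hx
    rw [hx]
    exact h _ ((norm_ev_le x u).trans (by gcongr))
  have hmeas : ∀ u : Hs d s, AEStronglyMeasurable fun x => fderiv ℝ f (u.toL2 x) := fun u =>
    (hf.continuous_fderiv (by simp)).comp_aestronglyMeasurable (Lp.aestronglyMeasurable _)
  have hB' : ∀ u : Hs d s, ∃ T : L2 d →L[ℝ] L2 d,
      -- Quantified over all `C` because the operator is fixed before `R`; its almost everywhere
      -- values determine it, so any admissible bound applies.
      (∀ C : ℝ, 0 ≤ C → (∀ᵐ x, ‖fderiv ℝ f (u.toL2 x)‖ ≤ C) → ‖T‖ ≤ C) ∧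
      ∀ v : L2 d, T v =ᵐ[volume] fun x => fderiv ℝ f (u.toL2 x) (v x) := fun u => by
    obtain ⟨C, hC, h⟩ := hbound ‖u‖
    obtain ⟨T, -, hT⟩ := exists_mulOperator (hmeas u) hC.le (h u le_rfl)
    refine ⟨T, fun C' hC' h' => ?_, hT⟩
    obtain ⟨T', hT'C, hT'⟩ := exists_mulOperator (hmeas u) hC' h'
    have : T = T' := by
      ext1 v
      exact Lp.ext ((hT v).trans (hT' v).symm)
    rwa [this]
  choose B' hB'norm hB'ev using hB'
  have hBae : ∀ u, ⇑(B u).toL2 =ᵐ[volume] fun x => f (u.toL2 x) := fun u => by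
    filter_upwards [toL2_ae_eq u, toL2_ae_eq (B u)] with x h1 h2
    rw [h1, h2, hBev]
  refine ⟨B, B', hBae, fun R hR => ?_, hB'ev, fun R ε hR hε => ?_⟩
  · obtain ⟨g, hg⟩ := hcomp R
    obtain ⟨K, hK⟩ := exists_norm_schwartzComp_sub_le (d := d) (s := s) g R hR.le
    -- The Schwartz function used to define `B u` depended on `‖u‖`; on the ball a single `g` gives
    -- the same element.
    have e : ∀ u : Hs d s, ‖u‖ ≤ R → B u = schwartzComp g u := fun u hu =>
      ext_ev fun x => by rw [hBev, hg u hu]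
    refine ⟨K, LipschitzOnWith.of_dist_le_mul fun u hu v hv => ?_⟩
    rw [mem_closedBall_zero_iff] at hu hv
    rw [dist_eq_norm, dist_eq_norm, e u hu, e v hv]
    exact hK u v hu hv
  · obtain ⟨C, hC, hCb⟩ := hbound R
    obtain ⟨δ, hδ, h⟩ := exists_norm_sub_sub_fderiv_le hf (E * R) hε
    -- This makes the supremum of `w`, at most `E * ‖w‖`, smaller than `δ`; the `+ 1` avoids
    -- division by zero.
    refine ⟨C, δ / (E + 1), hC, by positivity, fun u w hu hw => ⟨hB'norm u C hC.le (hCb u hu), ?_⟩⟩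
    refine Lp.norm_le_mul_norm_of_ae_le_mul ?_
    filter_upwards [Lp.coeFn_sub ((B (u + w)).toL2 - (B u).toL2) (B' u w.toL2),
      Lp.coeFn_sub (B (u + w)).toL2 (B u).toL2, hB'ev u w.toL2, toL2_ae_eq u, toL2_ae_eq w,
      toL2_ae_eq (B u), toL2_ae_eq (B (u + w))] with x h1 h2 h3 h4 h5 h6 h7
    rw [h1, Pi.sub_apply, h2, Pi.sub_apply, h3, h4, h5, h6, h7, hBev, hBev, map_add]
    refine h _ _ ((norm_ev_le x u).trans (by gcongr)) ((norm_ev_le x w).trans_lt ?_)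
    rw [lt_div_iff₀ (by positivity)] at hw
    nlinarith [norm_nonneg w]
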